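/- **Theorem 3.25 (Piecewise polynomiality of $\gamma\mapsto K_{\Phi(\eta)}(\gamma)$).** Let $\eta=(\eta_1,\dots,\eta_p)$ be a composition of $n$ with positive parts, and put $r_k=\eta_1+\cdots+\eta_k$, $r_0=0$. Assume $p\ge 2$ or $n=1$. Let $$\Phi(\eta)=\{(i,j)\in\mathbb Z^2 \mid 1\le i\le r_k<j\le n\ \text{for some } k,\ 1\le k\le p\},$$ and for $\gamma\in\mathbb Z^n$ with $\gamma_1+\cdots+\gamma_n=0$ let $K_{\Phi(\eta)}(\gamma)$ be the number of families $(m_{ij})_{(i,j)\in\Phi(\eta)}$ of non-negative integers with $\sum_{(i,j)\in\Phi(\eta)} m_{ij}(e_i-e_j)=\gamma$, where $e_1,\dots,e_n$ is the standard basis (equivalently, the coefficient of $x^\gamma$ in $\prod_{(i,j)\in\Phi(\eta)}(1-x_i/x_j)^{-1}$). Let $Y_\eta^{\mathbb R}$ be the set of $\gamma\in\mathbb R^n$ such that $\gamma_1+\cdots+\gamma_n=0$ and $$\sum_{j=1}^{r_k}\gamma_j+\sum_{a\in\Omega}\gamma_a\ge 0\qquad\text{for all } 0\le k\le p-1 \text{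 and all } \Omega\subseteq\{r_k+1,\dots,r_{k+1}\},$$ and let $Y_\eta=Y_\eta^{\mathbb R}\cap\mathbb Z^n$. Then on $Y_\eta$ the function $\gamma\mapsto K_{\Phi(\eta)}(\gamma)$ is a continuous piecewise polynomial function of degree $$\sum_{1\le i<j\le p}\eta_i\eta_j-n+1 .$$ That is, there is a function $F:\mathbb R^n\to\mathbb R$, continuous on $Y_\eta^{\mathbb R}$, with $F(\gamma)=K_{\Phi(\eta)}(\gamma)$ for all $\gamma\in Y_\eta$, and such that $Y_\eta^{\mathbb R}$ is a finite union of closed rational polyhedral cones (each given by finitely many homogeneous linear inequalities with integer coefficients) on each of which $F$ coincides with a polynomial in $\gamma_1,\dots,\gamma_n$ with rational coefficients; the smallest $d\ge 0$ for which the cones and polynomials can be chosen with all polynomials of total degree at most $d$ is $d=\sum_{1\le i<j\le p}\eta_i\eta_j-n+1$. -/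

import Mathlib

namespace ParabolicKostant

/-- The set `Φ(η)` of pairs `(i, j)` separated by some partial sum `r_k = η₁ + ⋯ + η_k`,
`1 ≤ k ≤ p`. With indices `1, …, n` the condition reads `i ≤ r_k < j`; here the indices are
`0, …, n - 1`, so it reads `i < r_k ≤ j`. -/
def Phi {n : ℕ} (η : Composition n) : Finset (Fin n × Fin n) :=
  {ij | ∃ k : Fin (η.length + 1), 1 ≤ (k : ℕ) ∧
    (ij.1 : ℕ) < η.sizeUpTo k ∧ η.sizeUpTo k ≤ (ij.2 : ℕ)}

/-- The exponent vector `e_i - e_j` of the monomial `x_i / x_j`. -/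
def root {n : ℕ} (ij : Fin n × Fin n) : Fin n → ℤ :=
  Pi.single ij.1 1 - Pi.single ij.2 1

/-- The families `(m_{ij})`, `(i, j) ∈ Φ(η)`, of non-negative integers such that
`∑ m_{ij} (e_i - e_j) = γ`. -/
def kostantPartitions {n : ℕ} (η : Composition n) (γ : Fin n → ℤ) :
    Set ({ij // ij ∈ Phi η} → ℕ) :=
  {m | ∑ ij, m ij • root ij.1 = γ}

/-- There are only finitely many partitions of a given `γ`, so that counting them with
`Set.ncard` is meaningful. -/
theorem kostantPartitions_finite {n : ℕ} (η : Composition n) (γ : Fin n → ℤ) :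
    (kostantPartitions η γ).Finite := by
  set B : ℕ := (∑ i : Fin n, -((i : ℕ) : ℤ) * γ i).toNat with hB
  refine (Set.finite_Iic (fun _ : {ij // ij ∈ Phi η} => B)).subset ?_
  intro m hm ij
  have hm' : ∑ ij, m ij • root ij.1 = γ := hm
  have key : ∀ ab : {ij // ij ∈ Phi η},
      (1 : ℤ) ≤ ∑ i : Fin n, -((i : ℕ) : ℤ) * root ab.1 i := by
    rintro ⟨⟨a, b⟩, hab⟩
    simp only [Phi, Finset.mem_filter] at hab
    obtain ⟨-, k, -, h1, h2⟩ := hab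
    simp only [root, Pi.sub_apply, mul_sub, Finset.sum_sub_distrib, Pi.single_apply,
      mul_ite, mul_one, mul_zero, Finset.sum_ite_eq', Finset.mem_univ, if_true]
    omega
  have e : ∑ i : Fin n, -((i : ℕ) : ℤ) * γ i
      = ∑ ab : {ij // ij ∈ Phi η}, (m ab : ℤ) * ∑ i : Fin n, -((i : ℕ) : ℤ) * root ab.1 i := by
    rw [← hm']
    simp only [Finset.sum_apply, Pi.smul_apply, Finset.mul_sum]
    rw [Finset.sum_comm]
    refine Finset.sum_congr rfl fun ab _ => Finset.sum_congr rfl fun i _ => ?_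
    rw [nsmul_eq_mul]
    ring
  have h1 : (m ij : ℤ) ≤ ∑ i : Fin n, -((i : ℕ) : ℤ) * γ i := by
    rw [e]
    have h2 : ∀ ab ∈ (Finset.univ : Finset {ij // ij ∈ Phi η}),
        (0 : ℤ) ≤ (m ab : ℤ) * ∑ i : Fin n, -((i : ℕ) : ℤ) * root ab.1 i :=
      fun ab _ => mul_nonneg (Int.natCast_nonneg _) (by linarith [key ab])
    refine le_trans ?_ (Finset.single_le_sum h2 (Finset.mem_univ ij))
    exact le_mul_of_one_le_right (Int.natCast_nonneg _) (key ij)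
  show m ij ≤ B
  omega

/-- The parabolic Kostant partition function `K_{Φ(η)}(γ)`: the number of ways to write `γ` as
a combination of the vectors `e_i - e_j`, `(i, j) ∈ Φ(η)`, with non-negative integer
coefficients, i.e. the coefficient of `x^γ` in `∏_{(i, j) ∈ Φ(η)} (1 - x_i / x_j)⁻¹`. -/
noncomputable def kostantK {n : ℕ} (η : Composition n) (γ : Fin n → ℤ) : ℕ :=
  (kostantPartitions η γ).ncard

/-- The set `Y_η` over an ordered ring `R`: vectors with coordinate sum zero such that for every
`0 ≤ k ≤ p - 1` and every set `Ω` of positions in the `(k + 1)`-st block of `η`, the sum of the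
coordinates in the first `k` blocks and in `Ω` is non-negative. `Y ℤ η` is the set on which
the partition function is considered, `Y ℝ η` is the corresponding real cone. -/
def Y (R : Type*) [CommRing R] [LinearOrder R] [IsStrictOrderedRing R] {n : ℕ}
    (η : Composition n) : Set (Fin n → R) :=
  {γ | ∑ i, γ i = 0 ∧ ∀ k < η.length, ∀ Ω : Finset (Fin n),
    (∀ a ∈ Ω, η.sizeUpTo k ≤ (a : ℕ) ∧ (a : ℕ) < η.sizeUpTo (k + 1)) →
      0 ≤ ∑ j with (j : Fin n).val < η.sizeUpTo k, γ j + ∑ a ∈ Ω, γ a}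

/-- A (closed, convex) rational polyhedral cone in `ℝⁿ`: the solution set of finitely many
homogeneous linear inequalities with integer coefficients. -/
def IsRationalPolyhedralCone {n : ℕ} (C : Set (Fin n → ℝ)) : Prop :=
  ∃ A : Finset (Fin n → ℤ), C = {x | ∀ a ∈ A, 0 ≤ ∑ i, (a i : ℝ) * x i}

/-- `F` is piecewise polynomial of degree at most `d` on `D ⊆ ℝⁿ`: the set `D` is a finite union
of rational polyhedral cones, on each of which `F` coincides with a polynomial with rational
coefficients of total degree at most `d`. -/
def IsPiecewisePolynomialOfDegreeLE {n : ℕ} (D : Set (Fin n → ℝ)) (F : (Fin n → ℝ) → ℝ)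
    (d : ℕ) : Prop :=
  ∃ (N : ℕ) (C : Fin N → Set (Fin n → ℝ)) (p : Fin N → MvPolynomial (Fin n) ℚ),
    (∀ s, IsRationalPolyhedralCone (C s)) ∧ D = ⋃ s, C s ∧
    ∀ s, (p s).totalDegree ≤ d ∧ ∀ x ∈ C s, F x = MvPolynomial.aeval x (p s)

/-- `F` is piecewise polynomial of degree (exactly) `d` on `D`: it is piecewise polynomial of
degree at most `d`, and `d` is the smallest such bound. (Minimality makes the notion independent
of the choice of the polynomials, which are not unique when `D` spans a proper subspace.) -/
def IsPiecewisePolynomialOfDegree {n : ℕ} (D : Set (Fin n → ℝ)) (F : (Fin n → ℝ) → ℝ)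
    (d : ℕ) : Prop :=
  IsLeast {e : ℕ | IsPiecewisePolynomialOfDegreeLE D F e} d

end ParabolicKostant

/-! ### Unimodular bases of roots and the exchange of one root -/

namespace ParabolicKostant

open Finset

/-! Only the block index ("level") of a position matters: `Φ` consists of the pairs along which the
level increases, and the real cone consists of the zero-sum vectors with non-negative sums over sets
closed under passing to lower levels.

Upper bound. Fix a small generic `ξ` in the cone. A greedy flow argument (`exists_isFlowTree`) gives
a basis of `n - 1` roots from `Φ` whose open cone contains `ξ`. For these roots alone the partition
function is the indicator of their cone, and shifting lattice points by `ξ` keeps them off all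
walls. Adding a further root `β` means summing along the rays `γ - m β`. A ray meets a simplicial
cone in a segment, which is the initial piece up to the exit minus the initial piece up to the
entry; this gives a signed sum over cones in which `β` has replaced a basis root
(`ite_forall_pos_eq_sum`). Bases of roots are unimodular (`form_root_trichotomy`), so the number of
summands is integral affine in `γ` and each summation raises the degree by at most one
(`exists_sum_poly`). The result is a combination of polynomials of degree at most `#Φ - (n - 1)`,
cut off to cones (`countOn_mem_coneSpan`). All walls of these cones are subset-sum hyperplanes, so
on the closed chamber of `ξ` a single polynomial remains (`exists_poly_of_mem_coneSpan`).

Gluing. Finitely many such chambers cover the cone (`exists_smallGeneric_chamber`). Two chamber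
polynomials agree at the lattice points of the intersection, hence on all of it, since it is a
rational cone (`aeval_eq_zero_of_cone`). Continuity follows because the pieces are closed and finite
in number.

Lower bound. The `(T + 1) ^ #Φ` families with entries at most `T` have only `O(T ^ (n - 1))` sums,
each attained `O(T ^ d)` times if the degree is at most `d`; so `#Φ ≤ n - 1 + d`
(`card_levRoots_le`). -/

theorem dotProduct_root {n : ℕ} (l : Fin n → ℤ) (e : Fin n × Fin n) :
    l ⬝ᵥ root e = l e.1 - l e.2 := by
  simp [root, dotProduct_sub]

theorem sum_root {n : ℕ} (e : Fin n × Fin n) : ∑ i, root e i = 0 := by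
  simp [root, Finset.sum_sub_distrib]

/-- A basis of the lattice of integer vectors with coordinate sum zero that consists of roots
from `Φ`, together with integer linear forms that compute the coordinates. -/
structure Frame {n : ℕ} (Φ : Finset (Fin n × Fin n)) (ι : Type) [Fintype ι] [DecidableEq ι] where
  /-- the roots of the basis -/
  edge : ι → Fin n × Fin n
  /-- the coordinate forms -/
  form : ι → Fin n → ℤ
  mem : ∀ t, edge t ∈ Φ
  dual : ∀ s t, form s ⬝ᵥ root (edge t) = if s = t then 1 else 0
  expand : ∀ γ : Fin n → ℤ, ∑ i, γ i = 0 → ∑ t, (form t ⬝ᵥ γ) • root (edge t) = γ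

/-- The value of an integer linear form on a real vector. -/
noncomputable def rform {n : ℕ} (l : Fin n → ℤ) (x : Fin n → ℝ) : ℝ := ∑ i, (l i : ℝ) * x i

theorem rform_add {n : ℕ} (l : Fin n → ℤ) (x y : Fin n → ℝ) :
    rform l (x + y) = rform l x + rform l y := by
  simp [rform, mul_add, Finset.sum_add_distrib]

theorem rform_sub_smul {n : ℕ} (l l' : Fin n → ℤ) (c : ℤ) (x : Fin n → ℝ) :
    rform (l - c • l') x = rform l x - c * rform l' x := by
  simp only [rform, Pi.sub_apply, Pi.smul_apply, smul_eq_mul, Finset.mul_sum,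
    ← Finset.sum_sub_distrib]
  exact Finset.sum_congr rfl fun i _ => by push_cast; ring

theorem rform_zsmul {n : ℕ} (l : Fin n → ℤ) (c : ℤ) (x : Fin n → ℝ) :
    rform (c • l) x = c * rform l x := by
  simp only [rform, Pi.smul_apply, smul_eq_mul, Finset.mul_sum]
  exact Finset.sum_congr rfl fun i _ => by push_cast; ring

theorem rform_intCast {n : ℕ} (l γ : Fin n → ℤ) :
    rform l (fun i => (γ i : ℝ)) = ((l ⬝ᵥ γ : ℤ) : ℝ) := by
  simp [rform, dotProduct]

namespace Frame

variable {n : ℕ} {Φ : Finset (Fin n × Fin n)} {ι : Type} [Fintype ι] [DecidableEq ι]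

theorem edge_injective (B : Frame Φ ι) : Function.Injective B.edge := by
  intro s t h
  by_contra hst
  have h1 := B.dual s s
  have h2 := B.dual s t
  rw [h] at h1
  simp [h1] at h2
  exact hst h2

theorem dotProduct_expand (B : Frame Φ ι) (μ γ : Fin n → ℤ) (hγ : ∑ i, γ i = 0) :
    ∑ t, (B.form t ⬝ᵥ γ) * (μ ⬝ᵥ root (B.edge t)) = μ ⬝ᵥ γ := by
  conv_rhs => rw [← B.expand γ hγ]
  rw [dotProduct_sum]
  simp [-zsmul_eq_mul]

/-- The indicator `μ` of the level set of `form t` through `e.1` is constant along every basis root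
except the `t`-th. Expanding `root e` therefore leaves one term: if the coefficient is non-zero, its
product with an integer is `1`, so it is a unit. -/
theorem form_root_trichotomy (B : Frame Φ ι) (t : ι) (e : Fin n × Fin n) :
    B.form t ⬝ᵥ root e = 1 ∨ B.form t ⬝ᵥ root e = 0 ∨ B.form t ⬝ᵥ root e = -1 := by
  rw [or_left_comm]
  by_cases h : B.form t ⬝ᵥ root e = 0
  · exact Or.inl h
  refine Or.inr ?_
  set μ : Fin n → ℤ := fun i => if B.form t i = B.form t e.1 then 1 else 0 with hμ
  have h1 := B.dotProduct_expand μ (root e) (sum_root e)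
  rw [Finset.sum_eq_single t] at h1
  · rw [dotProduct_root μ e] at h1
    have h2 : μ e.1 - μ e.2 = 1 := by
      rw [dotProduct_root] at h
      have : B.form t e.2 ≠ B.form t e.1 := fun h' => h (by rw [h']; ring)
      simp [hμ, this]
    rw [h2] at h1
    exact Int.isUnit_iff.1 (IsUnit.of_mul_eq_one _ h1)
  · intro s _ hs
    have h3 := B.dual t s
    rw [if_neg (Ne.symm hs), dotProduct_root, sub_eq_zero] at h3
    rw [dotProduct_root μ]
    simp [hμ, h3]
  · simp

/-- Comparing with both ends of `edge t`, the trichotomy leaves only two values for `form t`,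
differing by one; the constant drops out on zero-sum vectors. Hence the walls of every frame cone
are subset-sum hyperplanes. -/
theorem exists_subset (B : Frame Φ ι) (t : ι) : ∃ S : Finset (Fin n), S ≠ ∅ ∧ S ≠ univ ∧
    ∀ x : Fin n → ℝ, ∑ i, x i = 0 → rform (B.form t) x = ∑ i ∈ S, x i := by
  set a := (B.edge t).1
  set b := (B.edge t).2
  have hab : B.form t a - B.form t b = 1 := by
    rw [← dotProduct_root]; simp [B.dual]
  have key : ∀ i, B.form t i = B.form t b + if B.form t i = B.form t a then 1 else 0 := by
    intro i
    have h1 := B.form_root_trichotomy t (i, a)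
    have h2 := B.form_root_trichotomy t (i, b)
    rw [dotProduct_root] at h1 h2
    simp only at h1 h2
    split_ifs <;> omega
  refine ⟨univ.filter fun i => B.form t i = B.form t a, ?_, ?_, ?_⟩
  · exact Finset.ne_empty_of_mem (a := a) (by simp)
  · intro h
    have : b ∈ univ.filter fun i => B.form t i = B.form t a := by rw [h]; simp
    simp at this
    omega
  · intro x hx
    rw [rform]
    have : ∀ i, (B.form t i : ℝ) * x i
        = B.form t b * x i + if B.form t i = B.form t a then x i else 0 := by
      intro i
      have h := key i
      split_ifs with hi
      · rw [if_pos hi] at h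
        rw [h]; push_cast; ring
      · rw [if_neg hi] at h
        rw [h]; push_cast; ring
    rw [Finset.sum_congr rfl fun i _ => this i, Finset.sum_add_distrib, ← Finset.mul_sum, hx,
      Finset.sum_filter]
    simp

/-- Replace one root of a frame by the root `β`, which has coefficient `±1` there. -/
def pivot (B : Frame Φ ι) (β : Fin n × Fin n) (hβ : β ∈ Φ) (t₀ : ι)
    (h : (B.form t₀ ⬝ᵥ root β) * (B.form t₀ ⬝ᵥ root β) = 1) : Frame Φ ι where
  edge := Function.update B.edge t₀ β
  form := fun t => if t = t₀ then (B.form t₀ ⬝ᵥ root β) • B.form t₀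
    else B.form t - ((B.form t₀ ⬝ᵥ root β) * (B.form t ⬝ᵥ root β)) • B.form t₀
  mem := by
    intro t
    by_cases ht : t = t₀
    · subst ht; simpa using hβ
    · simpa [ht] using B.mem t
  dual := by
    intro s t
    by_cases hs : s = t₀ <;> by_cases ht : t = t₀
    · subst hs; subst ht; simp [h, -zsmul_eq_mul]
    · subst hs
      simp [ht, Ne.symm ht, B.dual, -zsmul_eq_mul]
    · subst ht
      simp only [hs, if_false, Function.update_self, sub_dotProduct, smul_dotProduct, smul_eq_mul]
      linear_combination (-(B.form s ⬝ᵥ root β)) * h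
    · simp [hs, ht, Ne.symm ht, B.dual, -zsmul_eq_mul]
  expand := by
    intro γ hγ
    set ε := B.form t₀ ⬝ᵥ root β
    have hβ' := B.expand (root β) (sum_root β)
    have hγ' := B.expand γ hγ
    -- Summed over `t`, the middle terms recombine to a multiple of `root β` that the last term
    -- cancels.
    have e1 : ∀ t, ((if t = t₀ then ε • B.form t₀
        else B.form t - (ε * (B.form t ⬝ᵥ root β)) • B.form t₀) ⬝ᵥ γ) •
          root (Function.update B.edge t₀ β t)
        = (B.form t ⬝ᵥ γ) • root (B.edge t)
          - (ε * (B.form t₀ ⬝ᵥ γ)) • (B.form t ⬝ᵥ root β) • root (B.edge t)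
          + if t = t₀ then (ε * (B.form t₀ ⬝ᵥ γ)) • root β else 0 := by
      intro t
      by_cases ht : t = t₀
      · subst ht
        simp only [if_true, Function.update_self, smul_dotProduct, smul_eq_mul]
        rw [smul_smul, show ε * (B.form t ⬝ᵥ γ) * (B.form t ⬝ᵥ root β) = B.form t ⬝ᵥ γ by
          linear_combination (B.form t ⬝ᵥ γ) * h]
        simp
      · simp only [ht, if_false, ne_eq, not_false_eq_true, Function.update_of_ne, sub_dotProduct,
          smul_dotProduct, smul_eq_mul, sub_smul, add_zero, smul_smul]
        congr 2
        ring
    rw [Finset.sum_congr rfl fun t _ => e1 t, Finset.sum_add_distrib, Finset.sum_sub_distrib,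
      hγ', ← Finset.smul_sum, hβ']
    simp

theorem rform_pivot_self (B : Frame Φ ι) (β : Fin n × Fin n) (hβ : β ∈ Φ) (t₀ : ι)
    (h : (B.form t₀ ⬝ᵥ root β) * (B.form t₀ ⬝ᵥ root β) = 1) (x : Fin n → ℝ) :
    rform ((B.pivot β hβ t₀ h).form t₀) x = (B.form t₀ ⬝ᵥ root β : ℤ) * rform (B.form t₀) x := by
  simp [pivot, rform_zsmul, -zsmul_eq_mul]

theorem rform_pivot_of_ne (B : Frame Φ ι) (β : Fin n × Fin n) (hβ : β ∈ Φ) (t₀ : ι)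
    (h : (B.form t₀ ⬝ᵥ root β) * (B.form t₀ ⬝ᵥ root β) = 1) (x : Fin n → ℝ) {t : ι} (ht : t ≠ t₀) :
    rform ((B.pivot β hβ t₀ h).form t) x = rform (B.form t) x -
      (B.form t₀ ⬝ᵥ root β : ℤ) * (B.form t ⬝ᵥ root β : ℤ) * rform (B.form t₀) x := by
  simp only [pivot, if_neg ht, rform_sub_smul]
  push_cast
  ring

end Frame

/-- A vector of coordinate sum zero, all of whose proper subset sums are non-zero and
smaller than `1` in absolute value. -/
structure IsSmallGeneric {n : ℕ} (ξ : Fin n → ℝ) : Prop where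
  sum_eq_zero : ∑ i, ξ i = 0
  sum_ne_zero : ∀ S : Finset (Fin n), S ≠ ∅ → S ≠ univ → ∑ i ∈ S, ξ i ≠ 0
  abs_sum_lt : ∀ S : Finset (Fin n), |∑ i ∈ S, ξ i| < 1

namespace Frame

variable {n : ℕ} {Φ : Finset (Fin n × Fin n)} {ι : Type} [Fintype ι] [DecidableEq ι]

theorem rform_ne_zero (B : Frame Φ ι) {ξ : Fin n → ℝ} (hξ : IsSmallGeneric ξ) (t : ι) :
    rform (B.form t) ξ ≠ 0 ∧ |rform (B.form t) ξ| < 1 := by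
  obtain ⟨S, h1, h2, h3⟩ := B.exists_subset t
  rw [h3 ξ hξ.sum_eq_zero]
  exact ⟨hξ.sum_ne_zero S h1 h2, hξ.abs_sum_lt S⟩

/-- The value is an integer plus a non-zero number of absolute value below one. In particular no
shifted lattice point lies on a wall of any frame cone. -/
theorem rform_shift_ne_int (B : Frame Φ ι) {ξ : Fin n → ℝ} (hξ : IsSmallGeneric ξ) (t : ι)
    (γ : Fin n → ℤ) (k : ℤ) : rform (B.form t) ((fun i => (γ i : ℝ)) + ξ) ≠ k := by
  obtain ⟨h1, h2⟩ := B.rform_ne_zero hξ t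
  rw [rform_add, rform_intCast]
  intro h
  have h3 : rform (B.form t) ξ = ((k - B.form t ⬝ᵥ γ : ℤ) : ℝ) := by push_cast; linarith
  rw [h3] at h1 h2
  have h4 : |k - B.form t ⬝ᵥ γ| < 1 := by exact_mod_cast h2
  rw [Int.abs_lt_one_iff] at h4
  rw [h4] at h1
  simp at h1

end Frame

end ParabolicKostant

/-! ### Summation of polynomials along a ray -/

namespace ParabolicKostant

open Finset

/-- The value of a rational polynomial at an integer vector. -/
noncomputable def evalZ {n : ℕ} (P : MvPolynomial (Fin n) ℚ) (γ : Fin n → ℤ) : ℚ :=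
  MvPolynomial.eval (fun i => (γ i : ℚ)) P

theorem exists_affine_poly {n : ℕ} (l : Fin n → ℤ) (k : ℤ) :
    ∃ A : MvPolynomial (Fin n) ℚ, A.totalDegree ≤ 1 ∧
      ∀ γ : Fin n → ℤ, evalZ A γ = ((l ⬝ᵥ γ + k : ℤ) : ℚ) := by
  refine ⟨∑ i, MvPolynomial.C (l i : ℚ) * MvPolynomial.X i + MvPolynomial.C (k : ℚ), ?_, ?_⟩
  · refine (MvPolynomial.totalDegree_add _ _).trans (max_le ?_ ?_)
    · refine MvPolynomial.totalDegree_finsetSum_le fun i _ => ?_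
      refine (MvPolynomial.totalDegree_mul _ _).trans ?_
      rw [MvPolynomial.totalDegree_C, MvPolynomial.totalDegree_X]
    · rw [MvPolynomial.totalDegree_C]
      exact Nat.zero_le 1
  · intro γ
    simp only [evalZ, dotProduct, map_add, map_sum, map_mul, MvPolynomial.eval_C,
      MvPolynomial.eval_X]
    push_cast
    rfl

/-- Faulhaber's formula, with `A` in place of the number of summands. -/
theorem exists_sum_pow_poly (j : ℕ) {n : ℕ} (A : MvPolynomial (Fin n) ℚ)
    (hA : A.totalDegree ≤ 1) : ∃ Q : MvPolynomial (Fin n) ℚ, Q.totalDegree ≤ j + 1 ∧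
      ∀ (γ : Fin n → ℤ) (N : ℕ), evalZ A γ = N → evalZ Q γ = ∑ m ∈ range N, (m : ℚ) ^ j := by
  refine ⟨∑ i ∈ range (j + 1), MvPolynomial.C (bernoulli i * ((j + 1).choose i) / (j + 1)) *
    A ^ (j + 1 - i), ?_, ?_⟩
  · refine MvPolynomial.totalDegree_finsetSum_le fun i _ => ?_
    refine (MvPolynomial.totalDegree_mul _ _).trans ?_
    rw [MvPolynomial.totalDegree_C, zero_add]
    refine (MvPolynomial.totalDegree_pow _ _).trans ?_
    calc (j + 1 - i) * A.totalDegree ≤ (j + 1 - i) * 1 := by gcongr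
      _ ≤ j + 1 := by omega
  · intro γ N h
    rw [sum_range_pow]
    simp only [evalZ] at h ⊢
    rw [map_sum]
    refine Finset.sum_congr rfl fun i _ => ?_
    rw [map_mul, map_pow, h, MvPolynomial.eval_C]
    ring

/-- Peel off one variable: the `i`-th coordinate of `γ - m β` is `γ i - m β i`, whose second term
raises the power of `m`. This is why the induction carries the weight `m ^ j` for all `j`. -/
theorem exists_sum_monomial_poly {n : ℕ} (β : Fin n → ℤ) (A : MvPolynomial (Fin n) ℚ)
    (hA : A.totalDegree ≤ 1) (s : Fin n →₀ ℕ) : ∀ j : ℕ,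
    ∃ Q : MvPolynomial (Fin n) ℚ, Q.totalDegree ≤ s.degree + j + 1 ∧
      ∀ (γ : Fin n → ℤ) (N : ℕ), evalZ A γ = N →
        evalZ Q γ = ∑ m ∈ range N, (m : ℚ) ^ j *
          evalZ (MvPolynomial.monomial s 1) (γ - (m : ℤ) • β) := by
  induction h : s.degree generalizing s with
  | zero =>
    intro j
    obtain ⟨Q, hQ, hQ'⟩ := exists_sum_pow_poly j A hA
    refine ⟨Q, by omega, fun γ N hN => ?_⟩
    rw [Finsupp.degree_eq_zero_iff] at h
    subst h
    rw [hQ' γ N hN]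
    simp [evalZ]
  | succ d ih =>
    intro j
    have hs : s ≠ 0 := by rintro rfl; simp at h
    obtain ⟨i, hi⟩ := Finsupp.ne_iff.1 hs
    have hi' : 1 ≤ s i := Nat.one_le_iff_ne_zero.2 hi
    obtain ⟨s', rfl⟩ : ∃ s', s = s' + Finsupp.single i 1 :=
      ⟨s - Finsupp.single i 1, (tsub_add_cancel_of_le (by simpa using hi')).symm⟩
    have hd : s'.degree = d := by simpa using h
    obtain ⟨Q₁, h1, h1'⟩ := ih s' hd j
    obtain ⟨Q₂, h2, h2'⟩ := ih s' hd (j + 1)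
    refine ⟨MvPolynomial.X i * Q₁ - MvPolynomial.C (β i : ℚ) * Q₂, ?_, ?_⟩
    · refine (MvPolynomial.totalDegree_sub _ _).trans (max_le ?_ ?_)
      · refine (MvPolynomial.totalDegree_mul _ _).trans ?_
        rw [MvPolynomial.totalDegree_X]; omega
      · refine (MvPolynomial.totalDegree_mul _ _).trans ?_
        rw [MvPolynomial.totalDegree_C]; omega
    · intro γ N hN
      have e : ∀ δ : Fin n → ℤ,
          evalZ (MvPolynomial.monomial (s' + Finsupp.single i 1) 1) δ
            = δ i * evalZ (MvPolynomial.monomial s' 1) δ := by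
        intro δ
        rw [MvPolynomial.monomial_add_single]
        simp [evalZ, mul_comm]
      have e1 := h1' γ N hN
      have e2 := h2' γ N hN
      have e3 : evalZ (MvPolynomial.X i * Q₁ - MvPolynomial.C (β i : ℚ) * Q₂) γ
          = γ i * evalZ Q₁ γ - β i * evalZ Q₂ γ := by simp [evalZ]
      rw [e3, e1, e2, Finset.mul_sum, Finset.mul_sum, ← Finset.sum_sub_distrib]
      refine Finset.sum_congr rfl fun m _ => ?_
      rw [e]
      simp only [Pi.sub_apply, Pi.smul_apply, smul_eq_mul]
      push_cast
      ring

theorem exists_sum_poly {n : ℕ} (β l : Fin n → ℤ) (k : ℤ) (P : MvPolynomial (Fin n) ℚ) :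
    ∃ Q : MvPolynomial (Fin n) ℚ, Q.totalDegree ≤ P.totalDegree + 1 ∧
      ∀ (γ : Fin n → ℤ) (N : ℕ), (N : ℤ) = l ⬝ᵥ γ + k →
        evalZ Q γ = ∑ m ∈ range N, evalZ P (γ - (m : ℤ) • β) := by
  obtain ⟨A, hA, hA'⟩ := exists_affine_poly l k
  choose Q hQ hQ' using fun s => exists_sum_monomial_poly β A hA s 0
  refine ⟨∑ s ∈ P.support, MvPolynomial.C (P.coeff s) * Q s, ?_, ?_⟩
  · refine MvPolynomial.totalDegree_finsetSum_le fun s hs => ?_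
    refine (MvPolynomial.totalDegree_mul _ _).trans ?_
    rw [MvPolynomial.totalDegree_C]
    have h1 := hQ s
    have h2 : s.degree ≤ P.totalDegree := MvPolynomial.le_totalDegree hs
    omega
  · intro γ N hN
    have hAN : evalZ A γ = N := by rw [hA', ← hN]; simp
    have e1 : evalZ (∑ s ∈ P.support, MvPolynomial.C (P.coeff s) * Q s) γ
        = ∑ s ∈ P.support, P.coeff s * evalZ (Q s) γ := by simp [evalZ]
    have e2 : ∀ δ, evalZ P δ
        = ∑ s ∈ P.support, P.coeff s * evalZ (MvPolynomial.monomial s 1) δ := by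
      intro δ
      conv_lhs => rw [P.as_sum]
      simp only [evalZ, map_sum]
      refine Finset.sum_congr rfl fun s _ => ?_
      simp [MvPolynomial.eval_monomial]
    rw [e1, Finset.sum_congr rfl fun m _ => e2 _, Finset.sum_comm]
    refine Finset.sum_congr rfl fun s _ => ?_
    rw [hQ' s γ N hAN, Finset.mul_sum]
    simp

end ParabolicKostant

/-! ### A ray crossing a simplicial cone -/

namespace ParabolicKostant

open Finset

theorem sum_ite_eq_ite_exists {ι : Type*} [Fintype ι] (p : ι → Prop) [DecidablePred p]
    [Decidable (∃ t, p t)] (h : ∀ s t, p s → p t → s = t) :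
    ∑ t, (if p t then (1 : ℤ) else 0) = if ∃ t, p t then 1 else 0 := by
  split_ifs with h'
  · obtain ⟨t, ht⟩ := h'
    rw [Finset.sum_eq_single t, if_pos ht]
    · intro s _ hs
      exact if_neg fun hps => hs (h s t hps ht)
    · simp
  · push Not at h'
    exact Finset.sum_eq_zero fun t _ => if_neg (h' t)

open Classical in
/-- The points `m ≥ 0` of the ray `u - m c` with positive coordinates, as a signed combination
of rays in the pivoted cones. -/
theorem ite_forall_pos_eq_sum {ι : Type*} [Fintype ι] (u : ι → ℝ) (c : ι → ℤ)
    (hc : ∀ t, c t = 1 ∨ c t = 0 ∨ c t = -1) (m : ℝ) (hm : 0 ≤ m) (hU : ∃ t, c t = 1)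
    (hd : ∀ s t, s ≠ t → c t ≠ 0 → u s - c t * c s * u t ≠ 0)
    (hn : ∀ t, u t - m * c t ≠ 0) :
    (if ∀ t, 0 < u t - m * c t then (1 : ℤ) else 0) =
      ∑ t, if c t * c t = 1 ∧ 0 < c t * u t ∧ (∀ s, s ≠ t → 0 < u s - c t * c s * u t) ∧
        m < c t * u t then c t else 0 := by
  -- `p t`: the ray leaves the cone through the facet `t`, at the parameter `u t`, beyond `m`. `q
  -- t`: it enters through the facet `t`, at the parameter `-u t`, beyond `m`.
  set p : ι → Prop := fun t => c t = 1 ∧ 0 < u t ∧ (∀ s, s ≠ t → 0 < u s - c s * u t) ∧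
    m < u t with hp
  set q : ι → Prop := fun t => c t = -1 ∧ 0 < -u t ∧ (∀ s, s ≠ t → 0 < u s + c s * u t) ∧
    m < -u t with hq
  have e : ∀ t, (if c t * c t = 1 ∧ 0 < c t * u t ∧
      (∀ s, s ≠ t → 0 < u s - c t * c s * u t) ∧ m < c t * u t then c t else 0)
      = (if p t then (1 : ℤ) else 0) - if q t then 1 else 0 := by
    intro t
    simp only [hp, hq]
    rcases hc t with h | h | h
    · simp [h]
    · simp [h]
    · simp only [h]
      norm_num
      split_ifs <;> rfl
  rw [Finset.sum_congr rfl fun t _ => e t, Finset.sum_sub_distrib,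
    sum_ite_eq_ite_exists p, sum_ite_eq_ite_exists q]
  rotate_left
  · intro s t hs ht
    by_contra hst
    have h1 := hs.2.2.1 t (Ne.symm hst)
    have h2 := ht.2.2.1 s hst
    rw [ht.1] at h1
    rw [hs.1] at h2
    push_cast at h1 h2
    linarith
  · intro s t hs ht
    by_contra hst
    have h1 := hs.2.2.1 t (Ne.symm hst)
    have h2 := ht.2.2.1 s hst
    rw [hs.1] at h2
    rw [ht.1] at h1
    push_cast at h1 h2
    linarith
  -- the smallest upper bound
  obtain ⟨b, hb, hbmin⟩ := Finset.exists_min_image (univ.filter fun t => c t = 1) u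
    (by obtain ⟨t, ht⟩ := hU; exact ⟨t, by simpa using ht⟩)
  simp only [mem_filter, mem_univ, true_and] at hb hbmin
  by_cases hall : ∀ t, 0 < u t - m * c t
  · rw [if_pos hall, if_pos, if_neg]
    · rfl
    · rintro ⟨t, ht, -, -, h3⟩
      have := hall t
      rw [ht] at this
      push_cast at this
      linarith
    · have hub := hall b
      rw [hb] at hub
      push_cast at hub
      refine ⟨b, hb, by linarith, ?_, by linarith⟩
      intro s hs
      have h1 := hall s
      rcases hc s with h | h | h
      · have h2 := hbmin s h
        have h3 := hd s b hs (by rw [hb]; norm_num)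
        rw [hb, h] at h3
        rw [h]
        push_cast at h3 ⊢
        rcases lt_or_eq_of_le h2 with h4 | h4
        · linarith
        · exact absurd (by linarith) h3
      · rw [h] at h1 ⊢
        push_cast at h1 ⊢
        linarith
      · rw [h] at h1 ⊢
        push_cast at h1 ⊢
        linarith
  rw [if_neg hall]
  -- The parameter `m` is now outside the segment. If the segment is non-empty and comes after `m`,
  -- then both its exit and its entry lie beyond `m`; otherwise neither does.
  suffices h : (∃ t, p t) ↔ ∃ t, q t by simp [h]
  constructor
  · rintro ⟨t, ht, h1, h2, h3⟩
    have hUpos : ∀ s, c s = 1 → m < u s := by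
      intro s hs
      by_cases hst : s = t
      · rw [hst]; exact h3
      · have := h2 s hst
        rw [hs] at this
        push_cast at this
        linarith
    push Not at hall
    obtain ⟨s, hs⟩ := hall
    have hs' : c s = -1 := by
      rcases hc s with h | h | h
      · have := hUpos s h
        rw [h] at hs
        push_cast at hs
        linarith
      · have hst : s ≠ t := by rintro rfl; omega
        have := h2 s hst
        rw [h] at this hs
        push_cast at this hs
        linarith
      · exact h
    obtain ⟨l, hl, hlmin⟩ := Finset.exists_min_image (univ.filter fun t => c t = -1) u
      ⟨s, by simpa using hs'⟩
    simp only [mem_filter, mem_univ, true_and] at hl hlmin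
    have hls : u l < -m := by
      have h4 := hlmin s hs'
      have h5 := hn s
      rw [hs'] at h5 hs
      push_cast at h5 hs
      have : u s - m * -1 < 0 := lt_of_le_of_ne hs h5
      linarith
    refine ⟨l, hl, by linarith, ?_, by linarith⟩
    intro r hr
    rcases hc r with h | h | h
    · rw [h]
      push_cast
      have h4 := h2 l (by rintro rfl; omega)
      rw [hl] at h4
      push_cast at h4
      by_cases hrt : r = t
      · rw [hrt]; linarith
      · have h5 := h2 r hrt
        rw [h] at h5
        push_cast at h5
        linarith
    · have h4 := h2 r (by rintro rfl; omega)
      rw [h] at h4 ⊢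
      push_cast at h4 ⊢
      linarith
    · have h4 := hlmin r h
      have h5 := hd r l hr (by rw [hl]; norm_num)
      rw [h, hl] at h5
      rw [h]
      push_cast at h5 ⊢
      rcases lt_or_eq_of_le h4 with h6 | h6
      · linarith
      · exact absurd (by linarith) h5
  · rintro ⟨l, hl, h1, h2, h3⟩
    have hbl : 0 < u b + u l := by
      have := h2 b (by rintro rfl; omega)
      rw [hb] at this
      push_cast at this
      linarith
    refine ⟨b, hb, by linarith, ?_, by linarith⟩
    intro r hr
    rcases hc r with h | h | h
    · have h4 := hbmin r h
      have h5 := hd r b hr (by rw [hb]; norm_num)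
      rw [h, hb] at h5
      rw [h]
      push_cast at h5 ⊢
      rcases lt_or_eq_of_le h4 with h6 | h6
      · linarith
      · exact absurd (by linarith) h5
    · have h4 := h2 r (by rintro rfl; omega)
      rw [h] at h4 ⊢
      push_cast at h4 ⊢
      linarith
    · rw [h]
      push_cast
      by_cases hrl : r = l
      · rw [hrl]; linarith
      · have h4 := h2 r hrl
        rw [h] at h4
        push_cast at h4
        linarith

end ParabolicKostant

/-! ### Polynomials cut off to cones, and their ray sums -/

namespace ParabolicKostant

open Finset

variable {n : ℕ} {Φ : Finset (Fin n × Fin n)} {ι : Type} [Fintype ι] [DecidableEq ι]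

open Classical in
/-- The function `f` cut off to the lattice points of the cone spanned by a frame; `ξ` decides
which boundary points belong to the cone. -/
noncomputable def coneFun (ξ : Fin n → ℝ) (B : Frame Φ ι) (f : (Fin n → ℤ) → ℚ)
    (γ : Fin n → ℤ) : ℚ :=
  if ∑ i, γ i = 0 ∧ ∀ t, 0 < rform (B.form t) ((fun i => (γ i : ℝ)) + ξ) then f γ else 0

variable (Φ ι) in
/-- The span of the polynomials of degree at most `d` cut off to cones of frames. -/
noncomputable def coneSpan (ξ : Fin n → ℝ) (d : ℕ) : Submodule ℚ ((Fin n → ℤ) → ℚ) :=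
  Submodule.span ℚ {g | ∃ (B : Frame Φ ι) (P : MvPolynomial (Fin n) ℚ),
    P.totalDegree ≤ d ∧ g = coneFun ξ B (evalZ P)}

/-- `f'` is the sum of `f` along the rays of direction `-β`, all but finitely many terms of which
vanish. -/
def IsRaySum (β : Fin n → ℤ) (f f' : (Fin n → ℤ) → ℚ) : Prop :=
  ∀ γ, ∃ M₀ : ℕ, ∀ M ≥ M₀, f' γ = ∑ m ∈ range M, f (γ - (m : ℤ) • β)

theorem IsRaySum.add {β : Fin n → ℤ} {f f' g g' : (Fin n → ℤ) → ℚ} (hf : IsRaySum β f f')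
    (hg : IsRaySum β g g') : IsRaySum β (f + g) (f' + g') := by
  intro γ
  obtain ⟨M₁, h1⟩ := hf γ
  obtain ⟨M₂, h2⟩ := hg γ
  refine ⟨max M₁ M₂, fun M hM => ?_⟩
  simp only [Pi.add_apply, Finset.sum_add_distrib]
  rw [h1 M (le_of_max_le_left hM), h2 M (le_of_max_le_right hM)]

theorem IsRaySum.smul {β : Fin n → ℤ} {f f' : (Fin n → ℤ) → ℚ} (hf : IsRaySum β f f')
    (r : ℚ) : IsRaySum β (r • f) (r • f') := by
  intro γ
  obtain ⟨M₁, h1⟩ := hf γ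
  refine ⟨M₁, fun M hM => ?_⟩
  simp only [Pi.smul_apply, ← Finset.smul_sum]
  rw [h1 M hM]

theorem IsRaySum.unique {β : Fin n → ℤ} {f f' f'' : (Fin n → ℤ) → ℚ} (hf : IsRaySum β f f')
    (hf' : IsRaySum β f f'') : f' = f'' := by
  funext γ
  obtain ⟨M₁, h1⟩ := hf γ
  obtain ⟨M₂, h2⟩ := hf' γ
  rw [h1 _ (le_max_left M₁ M₂), h2 _ (le_max_right M₁ M₂)]

namespace Frame

/-- The height `h` is positive on `β` and on all basis roots, so some coefficient of `β` is
positive, hence `1`. Geometrically, every ray of direction `-β` eventually leaves the cone. -/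
theorem exists_form_root_eq_one (B : Frame Φ ι) (h : Fin n → ℤ) (hh : ∀ e ∈ Φ, 0 < h ⬝ᵥ root e)
    {β : Fin n × Fin n} (hβ : β ∈ Φ) : ∃ t, B.form t ⬝ᵥ root β = 1 := by
  by_contra hne
  push Not at hne
  have h1 := hh β hβ
  rw [← B.dotProduct_expand h (root β) (sum_root β)] at h1
  refine absurd h1 (not_lt.2 (Finset.sum_nonpos fun t _ => ?_))
  have h2 := hh _ (B.mem t)
  have h3 := B.form_root_trichotomy t β
  have h4 := hne t
  exact mul_nonpos_of_nonpos_of_nonneg (by omega) h2.le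

theorem ceil_rform_shift (B : Frame Φ ι) (ξ : Fin n → ℝ) (t : ι) :
    ∃ k : ℤ, ∀ γ : Fin n → ℤ,
      ⌈rform (B.form t) ((fun i => (γ i : ℝ)) + ξ)⌉ = B.form t ⬝ᵥ γ + k := by
  refine ⟨⌈rform (B.form t) ξ⌉, fun γ => ?_⟩
  rw [rform_add, rform_intCast, Int.ceil_intCast_add]

open Classical in
theorem coneFun_pivot (B : Frame Φ ι) (ξ : Fin n → ℝ) (β : Fin n × Fin n) (hβ : β ∈ Φ) (t : ι)
    (h : (B.form t ⬝ᵥ root β) * (B.form t ⬝ᵥ root β) = 1) (f : (Fin n → ℤ) → ℚ)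
    (γ : Fin n → ℤ) (hγ : ∑ i, γ i = 0) :
    coneFun ξ (B.pivot β hβ t h) f γ =
      if 0 < (B.form t ⬝ᵥ root β : ℤ) * rform (B.form t) ((fun i => (γ i : ℝ)) + ξ) ∧
        ∀ s, s ≠ t → 0 < rform (B.form s) ((fun i => (γ i : ℝ)) + ξ) -
          (B.form t ⬝ᵥ root β : ℤ) * (B.form s ⬝ᵥ root β : ℤ) *
            rform (B.form t) ((fun i => (γ i : ℝ)) + ξ) then f γ else 0 := by
  unfold coneFun
  refine if_congr ⟨?_, ?_⟩ rfl rfl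
  · rintro ⟨-, h1⟩
    refine ⟨?_, fun s hs => ?_⟩
    · rw [← B.rform_pivot_self β hβ t h]; exact h1 t
    · rw [← B.rform_pivot_of_ne β hβ t h _ hs]; exact h1 s
  · rintro ⟨h1, h2⟩
    refine ⟨hγ, fun s => ?_⟩
    by_cases hs : s = t
    · subst hs; rw [B.rform_pivot_self β hβ]; exact h1
    · rw [B.rform_pivot_of_ne β hβ t h _ hs]; exact h2 s hs

open Classical in
-- The cut-off along the ray is a signed sum of initial segments, one for each possible pivot. The
-- `t`-th length is the ceiling of a coordinate of `γ + ξ` in the pivoted frame, an integral affine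
-- function of `γ`, so summing `P` over that segment gives a polynomial of degree at most one more.
theorem exists_isRaySum_coneFun (B : Frame Φ ι) {ξ : Fin n → ℝ} (hξ : IsSmallGeneric ξ)
    (h : Fin n → ℤ) (hh : ∀ e ∈ Φ, 0 < h ⬝ᵥ root e) {β : Fin n × Fin n} (hβ : β ∈ Φ)
    (P : MvPolynomial (Fin n) ℚ) :
    ∃ f' ∈ coneSpan Φ ι ξ (P.totalDegree + 1), IsRaySum (root β) (coneFun ξ B (evalZ P)) f' := by
  set c : ι → ℤ := fun t => B.form t ⬝ᵥ root β with hc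
  have hct : ∀ t, c t = 1 ∨ c t = 0 ∨ c t = -1 := fun t => B.form_root_trichotomy t β
  have hQ : ∀ t, ∃ Q : MvPolynomial (Fin n) ℚ, Q.totalDegree ≤ P.totalDegree + 1 ∧
      (c t * c t = 1 → ∀ (γ : Fin n → ℤ) (N : ℕ),
        (N : ℤ) = ⌈c t * rform (B.form t) ((fun i => (γ i : ℝ)) + ξ)⌉ →
        evalZ Q γ = ∑ m ∈ range N, evalZ P (γ - (m : ℤ) • root β)) := by
    intro t
    by_cases ht : c t * c t = 1
    · obtain ⟨k, hk⟩ := (B.pivot β hβ t ht).ceil_rform_shift ξ t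
      obtain ⟨Q, h1, h2⟩ := exists_sum_poly (root β) ((B.pivot β hβ t ht).form t) k P
      refine ⟨Q, h1, fun _ γ N hN => h2 γ N ?_⟩
      rw [hN, ← hk, rform_pivot_self]
    · exact ⟨0, by simp, fun h => absurd h ht⟩
  choose Q hQd hQ using hQ
  refine ⟨∑ t, if ht : c t * c t = 1 then
    (c t : ℚ) • coneFun ξ (B.pivot β hβ t ht) (evalZ (Q t)) else 0, ?_, ?_⟩
  · refine Submodule.sum_mem _ fun t _ => ?_
    split_ifs with ht
    · exact Submodule.smul_mem _ _ (Submodule.subset_span ⟨_, _, hQd t, rfl⟩)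
    · exact Submodule.zero_mem _
  intro γ
  by_cases hγ : ∑ i, γ i = 0
  swap
  · refine ⟨0, fun M _ => ?_⟩
    trans (0 : ℚ)
    · rw [Finset.sum_apply]
      refine Finset.sum_eq_zero fun t _ => ?_
      split_ifs with ht
      · simp [coneFun, hγ]
      · rfl
    · refine (Finset.sum_eq_zero fun m _ => ?_).symm
      have : ¬ ∑ i, (γ - (m : ℤ) • root β) i = 0 := by
        simpa [Finset.sum_sub_distrib, ← Finset.mul_sum, sum_root, -zsmul_eq_mul] using hγ
      simp only [coneFun, this, false_and, if_false]
  set u : ι → ℝ := fun t => rform (B.form t) ((fun i => (γ i : ℝ)) + ξ) with hu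
  -- Any common bound for the lengths of the segments would do; their sum is one.
  refine ⟨∑ t, ⌈c t * u t⌉.toNat, fun M hM => ?_⟩
  have hM' : ∀ t, ⌈c t * u t⌉.toNat ≤ M := fun t =>
    (Finset.single_le_sum (f := fun t => ⌈c t * u t⌉.toNat) (fun _ _ => Nat.zero_le _)
      (mem_univ t)).trans hM
  have hterm : ∀ m ∈ range M, coneFun ξ B (evalZ P) (γ - (m : ℤ) • root β)
      = ∑ t, (if c t * c t = 1 ∧ 0 < c t * u t ∧ (∀ s, s ≠ t → 0 < u s - c t * c s * u t) ∧
        (m : ℝ) < c t * u t then (c t : ℚ) * evalZ P (γ - (m : ℤ) • root β) else 0) := by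
    intro m _
    have hsum : ∑ i, (γ - (m : ℤ) • root β) i = 0 := by
      simpa [Finset.sum_sub_distrib, ← Finset.mul_sum, sum_root, -zsmul_eq_mul] using hγ
    have hform : ∀ t, rform (B.form t) ((fun i => (((γ - (m : ℤ) • root β) i : ℤ) : ℝ)) + ξ)
        = u t - m * c t := by
      intro t
      simp only [hu, hc]
      rw [rform_add, rform_add, rform_intCast, rform_intCast, dotProduct_sub, dotProduct_smul]
      push_cast
      simp
      ring
    have key := ite_forall_pos_eq_sum u c hct m (Nat.cast_nonneg m)
      (B.exists_form_root_eq_one h hh hβ) ?_ ?_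
    · have e : coneFun ξ B (evalZ P) (γ - (m : ℤ) • root β)
          = ((if ∀ t, 0 < u t - m * c t then (1 : ℤ) else 0 : ℤ) : ℚ) *
            evalZ P (γ - (m : ℤ) • root β) := by
        simp only [coneFun, hsum, hform, true_and]
        split_ifs <;> simp
      rw [e, key, Int.cast_sum, Finset.sum_mul]
      refine Finset.sum_congr rfl fun t _ => ?_
      split_ifs <;> simp
    -- The difference is a coordinate of `γ + ξ` in the pivoted frame, for which `ξ` is equally
    -- generic.
    · intro s t hst ht
      have ht' : c t * c t = 1 := by rcases hct t with h | h | h <;> simp [h] at ht ⊢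
      have := (B.pivot β hβ t ht').rform_shift_ne_int hξ s γ 0
      rw [B.rform_pivot_of_ne β hβ t ht' _ hst] at this
      simpa using this
    · intro t
      have := B.rform_shift_ne_int hξ t γ (m * c t)
      rw [sub_ne_zero]
      simpa using this
  rw [Finset.sum_congr rfl hterm, Finset.sum_comm, Finset.sum_apply]
  refine Finset.sum_congr rfl fun t _ => ?_
  split_ifs with ht
  swap
  · simp [ht]
  rw [Pi.smul_apply, coneFun_pivot _ _ _ _ _ _ _ _ hγ]
  by_cases hcond : 0 < c t * u t ∧ (∀ s, s ≠ t → 0 < u s - c t * c s * u t)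
  · rw [if_pos hcond]
    have hN : ((⌈c t * u t⌉.toNat : ℕ) : ℤ) = ⌈c t * u t⌉ :=
      Int.toNat_of_nonneg (Int.ceil_nonneg hcond.1.le)
    rw [hQ t ht γ _ hN, smul_eq_mul, Finset.mul_sum]
    rw [← Finset.sum_subset (Finset.range_subset_range.2 (hM' t))]
    · refine Finset.sum_congr rfl fun m hm => ?_
      rw [if_pos]
      refine ⟨ht, hcond.1, hcond.2, ?_⟩
      rw [mem_range] at hm
      have : (m : ℤ) < ⌈c t * u t⌉ := by omega
      simpa using Int.lt_ceil.1 this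
    · intro m _ hm
      rw [if_neg]
      rintro ⟨-, -, -, h3⟩
      apply hm
      rw [mem_range]
      have : (m : ℤ) < ⌈c t * u t⌉ := Int.lt_ceil.2 (by simpa using h3)
      omega
  · rw [if_neg hcond, smul_zero]
    symm
    refine Finset.sum_eq_zero fun m _ => if_neg ?_
    rintro ⟨-, h1, h2, -⟩
    exact hcond ⟨h1, h2⟩

end Frame

theorem coneSpan_mono (ξ : Fin n → ℝ) {d d' : ℕ} (h : d ≤ d') :
    coneSpan Φ ι ξ d ≤ coneSpan Φ ι ξ d' := by
  refine Submodule.span_mono ?_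
  rintro g ⟨B, P, hP, rfl⟩
  exact ⟨B, P, hP.trans h, rfl⟩

theorem exists_isRaySum_of_mem_coneSpan {ξ : Fin n → ℝ} (hξ : IsSmallGeneric ξ)
    (h : Fin n → ℤ) (hh : ∀ e ∈ Φ, 0 < h ⬝ᵥ root e) {β : Fin n × Fin n} (hβ : β ∈ Φ) {d : ℕ}
    {f : (Fin n → ℤ) → ℚ} (hf : f ∈ coneSpan Φ ι ξ d) :
    ∃ f' ∈ coneSpan Φ ι ξ (d + 1), IsRaySum (root β) f f' := by
  induction hf using Submodule.span_induction with
  | mem g hg =>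
    obtain ⟨B, P, hP, rfl⟩ := hg
    obtain ⟨f', h1, h2⟩ := B.exists_isRaySum_coneFun hξ h hh hβ P
    exact ⟨f', coneSpan_mono ξ (by omega) h1, h2⟩
  | zero => exact ⟨0, Submodule.zero_mem _, fun γ => ⟨0, fun M _ => by simp⟩⟩
  | add x y _ _ hx hy =>
    obtain ⟨x', h1, h2⟩ := hx
    obtain ⟨y', h3, h4⟩ := hy
    exact ⟨x' + y', Submodule.add_mem _ h1 h3, h2.add h4⟩
  | smul r x _ hx =>
    obtain ⟨x', h1, h2⟩ := hx
    exact ⟨r • x', Submodule.smul_mem _ r h1, h2.smul r⟩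

/-- On the lattice points of the closed chamber of `ξ` a member of `coneSpan` is a polynomial. -/
theorem exists_poly_of_mem_coneSpan {ξ : Fin n → ℝ} (hξ : IsSmallGeneric ξ) {d : ℕ}
    {f : (Fin n → ℤ) → ℚ} (hf : f ∈ coneSpan Φ ι ξ d) :
    ∃ P : MvPolynomial (Fin n) ℚ, P.totalDegree ≤ d ∧ ∀ γ : Fin n → ℤ, ∑ i, γ i = 0 →
      (∀ S : Finset (Fin n), 0 < ∑ i ∈ S, ξ i → 0 ≤ ∑ i ∈ S, γ i) → f γ = evalZ P γ := by
  classical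
  induction hf using Submodule.span_induction with
  | mem g hg =>
    obtain ⟨B, P, hP, rfl⟩ := hg
    -- Each form is a subset sum, so after the shift `ξ` dictates its sign on the whole closed
    -- chamber: the cone contains all of these shifted points or none.
    by_cases hB : ∀ t, 0 < rform (B.form t) ξ
    · refine ⟨P, hP, fun γ h0 hγ => ?_⟩
      rw [coneFun, if_pos]
      refine ⟨h0, fun t => ?_⟩
      obtain ⟨S, -, -, hS⟩ := B.exists_subset t
      have h1 := hB t
      rw [rform_add]
      rw [hS ξ hξ.sum_eq_zero] at h1 ⊢
      rw [hS _ (by exact_mod_cast h0)]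
      have h2 : (0 : ℝ) ≤ ∑ i ∈ S, (γ i : ℝ) := by exact_mod_cast hγ S h1
      linarith
    · refine ⟨0, by simp, fun γ h0 hγ => ?_⟩
      push Not at hB
      obtain ⟨t, ht⟩ := hB
      rw [coneFun, if_neg]
      · simp [evalZ]
      rintro ⟨-, h⟩
      refine absurd (h t) (not_lt.2 ?_)
      obtain ⟨S, -, -, hS⟩ := B.exists_subset t
      rw [rform_add]
      have h3 := (B.rform_ne_zero hξ t).1
      rw [hS ξ hξ.sum_eq_zero] at ht h3 ⊢
      rw [hS _ (by exact_mod_cast h0)]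
      have h4 := Finset.sum_add_sum_compl S ξ
      have h5 := Finset.sum_add_sum_compl S γ
      rw [hξ.sum_eq_zero] at h4
      rw [h0] at h5
      have h6 := hγ Sᶜ (by
        have := lt_of_le_of_ne ht h3
        linarith)
      have h2 : ∑ i ∈ S, (γ i : ℝ) ≤ 0 := by
        have : ∑ i ∈ S, γ i ≤ 0 := by linarith
        exact_mod_cast this
      linarith
  | zero => exact ⟨0, by simp, fun γ _ _ => by simp [evalZ]⟩
  | add x y _ _ hx hy =>
    obtain ⟨P, h1, h2⟩ := hx
    obtain ⟨Q, h3, h4⟩ := hy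
    refine ⟨P + Q, (MvPolynomial.totalDegree_add _ _).trans (max_le h1 h3), fun γ h0 hγ => ?_⟩
    rw [Pi.add_apply, h2 γ h0 hγ, h4 γ h0 hγ]
    simp [evalZ]
  | smul r x _ hx =>
    obtain ⟨P, h1, h2⟩ := hx
    refine ⟨r • P, (MvPolynomial.totalDegree_smul_le _ _).trans h1, fun γ h0 hγ => ?_⟩
    rw [Pi.smul_apply, h2 γ h0 hγ]
    simp [evalZ]

end ParabolicKostant

/-! ### The partition function built up root by root -/

namespace ParabolicKostant

open Finset

variable {n : ℕ}

/-- The families of non-negative integers, supported in `S`, that write `γ` as a combination of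
roots. -/
def partitionsOn (S : Finset (Fin n × Fin n)) (γ : Fin n → ℤ) : Set (Fin n × Fin n → ℕ) :=
  {m | (∀ e ∉ S, m e = 0) ∧ ∑ e, (m e : ℤ) • root e = γ}

/-- The partition function of the roots in `S`. -/
noncomputable def countOn (S : Finset (Fin n × Fin n)) (γ : Fin n → ℤ) : ℚ :=
  ((partitionsOn S γ).ncard : ℚ)

theorem mul_le_of_mem_partitionsOn {S : Finset (Fin n × Fin n)} {h : Fin n → ℤ}
    (hh : ∀ e ∈ S, 0 < h ⬝ᵥ root e) {γ : Fin n → ℤ} {m : Fin n × Fin n → ℕ}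
    (hm : m ∈ partitionsOn S γ) (e : Fin n × Fin n) : (m e : ℤ) ≤ h ⬝ᵥ γ := by
  obtain ⟨h1, h2⟩ := hm
  have h3 : h ⬝ᵥ γ = ∑ e, (m e : ℤ) * (h ⬝ᵥ root e) := by
    rw [← h2, dotProduct_sum]
    simp only [dotProduct_smul, smul_eq_mul]
  have h4 : ∀ e, (m e : ℤ) ≤ (m e : ℤ) * (h ⬝ᵥ root e) := by
    intro e
    by_cases he : e ∈ S
    · exact le_mul_of_one_le_right (Int.natCast_nonneg _) (hh e he)
    · simp [h1 e he]
  rw [h3]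
  exact (h4 e).trans (Finset.single_le_sum (f := fun e => (m e : ℤ) * (h ⬝ᵥ root e))
    (fun e _ => (Int.natCast_nonneg _).trans (h4 e)) (mem_univ e))

theorem partitionsOn_finite {S : Finset (Fin n × Fin n)} {h : Fin n → ℤ}
    (hh : ∀ e ∈ S, 0 < h ⬝ᵥ root e) (γ : Fin n → ℤ) : (partitionsOn S γ).Finite := by
  refine (Set.finite_Iic (fun _ => (h ⬝ᵥ γ).toNat)).subset fun m hm e => ?_
  have := mul_le_of_mem_partitionsOn hh hm e
  show m e ≤ (h ⬝ᵥ γ).toNat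
  omega

/-- Either `β` is not used, or one copy of it can be removed. -/
theorem countOn_insert {S : Finset (Fin n × Fin n)} {h : Fin n → ℤ} {β : Fin n × Fin n}
    (hβ : β ∉ S) (hh : ∀ e ∈ insert β S, 0 < h ⬝ᵥ root e) (γ : Fin n → ℤ) :
    countOn (insert β S) γ = countOn S γ + countOn (insert β S) (γ - root β) := by
  set φ : (Fin n × Fin n → ℕ) → (Fin n × Fin n → ℕ) := fun m => m + Pi.single β 1
  have hφ : Function.Injective φ := fun m m' h => by simpa [φ] using h
  have hadd : ∀ m : Fin n × Fin n → ℕ,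
      ∑ e, ((φ m e : ℕ) : ℤ) • root e = ∑ e, (m e : ℤ) • root e + root β := by
    intro m
    simp only [φ, Pi.add_apply, Nat.cast_add, add_smul, Finset.sum_add_distrib]
    congr 1
    rw [Finset.sum_eq_single β]
    · simp
    · intro e _ he; simp [he]
    · simp
  have hset : partitionsOn (insert β S) γ
      = partitionsOn S γ ∪ φ '' partitionsOn (insert β S) (γ - root β) := by
    ext m
    constructor
    · rintro ⟨h1, h2⟩
      by_cases hmβ : m β = 0
      · left
        refine ⟨fun e he => ?_, h2⟩
        by_cases heβ : e = β
        · rw [heβ, hmβ]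
        · exact h1 e (by simp [heβ, he])
      · right
        have hm : φ (m - Pi.single β 1) = m := by
          funext e
          by_cases heβ : e = β
          · subst heβ
            simp only [φ, Pi.add_apply, Pi.sub_apply, Pi.single_eq_same]
            omega
          · simp [φ, heβ]
        refine ⟨m - Pi.single β 1, ⟨fun e he => ?_, ?_⟩, hm⟩
        · simp [h1 e he]
        · have := hadd (m - Pi.single β 1)
          rw [hm, h2] at this
          rw [this]; simp
    · rintro (⟨h1, h2⟩ | ⟨m, ⟨h1, h2⟩, rfl⟩)
      · exact ⟨fun e he => h1 e fun h => he (mem_insert_of_mem h), h2⟩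
      · refine ⟨fun e he => ?_, ?_⟩
        · have : e ≠ β := by rintro rfl; simp at he
          simp [φ, h1 e he, this]
        · rw [hadd, h2]; simp
  have hdisj : Disjoint (partitionsOn S γ) (φ '' partitionsOn (insert β S) (γ - root β)) := by
    rw [Set.disjoint_left]
    rintro _ ⟨h1, -⟩ ⟨m, -, rfl⟩
    have := h1 β hβ
    simp [φ] at this
  have hf := partitionsOn_finite hh γ
  rw [hset] at hf
  rw [countOn, hset, Set.ncard_union_eq hdisj (hf.subset Set.subset_union_left)
    (hf.subset Set.subset_union_right), Set.ncard_image_of_injective _ hφ]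
  simp [countOn]

/-- Iterating the recursion `M` times leaves a remainder at `γ - M β`. Once `M` exceeds the height
of `γ`, that vector has negative height and no partitions. -/
theorem isRaySum_countOn {S : Finset (Fin n × Fin n)} {h : Fin n → ℤ} {β : Fin n × Fin n}
    (hβ : β ∉ S) (hh : ∀ e ∈ insert β S, 0 < h ⬝ᵥ root e) :
    IsRaySum (root β) (countOn S) (countOn (insert β S)) := by
  intro γ
  have key : ∀ M : ℕ, countOn (insert β S) γ
      = ∑ m ∈ range M, countOn S (γ - (m : ℤ) • root β)
        + countOn (insert β S) (γ - (M : ℤ) • root β) := by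
    intro M
    induction M with
    | zero => simp
    | succ M ih =>
      rw [ih, countOn_insert hβ hh, Finset.sum_range_succ, add_assoc]
      congr 3
      push_cast
      rw [add_smul, one_smul, sub_sub]
  refine ⟨(h ⬝ᵥ γ).toNat + 1, fun M hM => ?_⟩
  rw [key M]
  suffices h0 : partitionsOn (insert β S) (γ - (M : ℤ) • root β) = ∅ by
    rw [countOn, h0]; simp
  rw [Set.eq_empty_iff_forall_notMem]
  intro m hm
  have h1 := mul_le_of_mem_partitionsOn hh hm β
  rw [dotProduct_sub, dotProduct_smul, smul_eq_mul] at h1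
  have h2 := hh β (mem_insert_self _ _)
  have h3 : (M : ℤ) ≤ M * (h ⬝ᵥ root β) := le_mul_of_one_le_right (Int.natCast_nonneg _) h2
  have h4 : (0 : ℤ) ≤ m β := Int.natCast_nonneg _
  omega

variable {Φ : Finset (Fin n × Fin n)} {ι : Type} [Fintype ι] [DecidableEq ι]

theorem sum_edge (B : Frame Φ ι) (m : Fin n × Fin n → ℕ) (hm : ∀ e ∉ univ.image B.edge, m e = 0) :
    ∑ e, (m e : ℤ) • root e = ∑ t, (m (B.edge t) : ℤ) • root (B.edge t) := by
  rw [← Finset.sum_image (s := univ) (g := B.edge) (f := fun e => (m e : ℤ) • root e)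
    (fun s _ t _ h => B.edge_injective h)]
  symm
  refine Finset.sum_subset (subset_univ _) fun e _ he => ?_
  simp [hm e he]

/-- Coefficients in a basis are unique, so there is one partition if all coordinates of `γ` are
non-negative and none otherwise. The coordinates of `ξ` lie strictly between `0` and `1`, so this
amounts to positivity of the coordinates of `γ + ξ`. -/
theorem countOn_frame (B : Frame Φ ι) {ξ : Fin n → ℝ} (hξ : IsSmallGeneric ξ)
    (hB : ∀ t, 0 < rform (B.form t) ξ) :
    countOn (univ.image B.edge) = coneFun ξ B (evalZ 1) := by
  classical
  funext γ
  have hpos : ∀ t, 0 < rform (B.form t) ((fun i => (γ i : ℝ)) + ξ) ↔ 0 ≤ B.form t ⬝ᵥ γ := by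
    intro t
    rw [rform_add, rform_intCast]
    have h1 := hB t
    have h2 := (abs_lt.1 (B.rform_ne_zero hξ t).2).2
    constructor
    · intro h
      have : (-1 : ℝ) < ((B.form t ⬝ᵥ γ : ℤ) : ℝ) := by linarith
      have : -1 < B.form t ⬝ᵥ γ := by exact_mod_cast this
      omega
    · intro h
      have : (0 : ℝ) ≤ ((B.form t ⬝ᵥ γ : ℤ) : ℝ) := by exact_mod_cast h
      linarith
  have hcoef : ∀ m ∈ partitionsOn (univ.image B.edge) γ, ∑ i, γ i = 0 ∧
      ∀ t, (m (B.edge t) : ℤ) = B.form t ⬝ᵥ γ := by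
    rintro m ⟨h1, h2⟩
    rw [sum_edge B m h1] at h2
    constructor
    · rw [← h2]
      simp only [Finset.sum_apply]
      rw [Finset.sum_comm]
      refine Finset.sum_eq_zero fun t _ => ?_
      simp only [Pi.smul_apply, smul_eq_mul]
      rw [← Finset.mul_sum, sum_root, mul_zero]
    · intro t
      rw [← h2, dotProduct_sum]
      simp [dotProduct_smul, B.dual, -zsmul_eq_mul, -natCast_zsmul]
  rw [coneFun]
  simp only [hpos]
  split_ifs with hγ
  · have : partitionsOn (univ.image B.edge) γ
        = {fun e => ∑ t, if B.edge t = e then (B.form t ⬝ᵥ γ).toNat else 0} := by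
      set m₀ : Fin n × Fin n → ℕ := fun e => ∑ t, if B.edge t = e then (B.form t ⬝ᵥ γ).toNat else 0
        with hm₀
      have h0 : ∀ e ∉ univ.image B.edge, m₀ e = 0 := by
        intro e he
        refine Finset.sum_eq_zero fun t _ => if_neg ?_
        rintro rfl
        simp at he
      have h1 : ∀ t, m₀ (B.edge t) = (B.form t ⬝ᵥ γ).toNat := by
        intro t
        simp only [hm₀, B.edge_injective.eq_iff]
        simp
      ext m
      rw [Set.mem_singleton_iff]
      constructor
      · intro hm
        funext e
        by_cases he : e ∈ univ.image B.edge
        · obtain ⟨t, -, rfl⟩ := mem_image.1 he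
          rw [h1, ← (hcoef m hm).2 t]
          simp
        · rw [hm.1 e he, h0 e he]
      · rintro rfl
        refine ⟨h0, ?_⟩
        rw [sum_edge B m₀ h0]
        conv_rhs => rw [← B.expand γ hγ.1]
        refine Finset.sum_congr rfl fun t _ => ?_
        rw [h1, Int.toNat_of_nonneg (hγ.2 t)]
    rw [countOn, this]
    simp [evalZ]
  · have : partitionsOn (univ.image B.edge) γ = ∅ := by
      rw [Set.eq_empty_iff_forall_notMem]
      intro m hm
      refine hγ ⟨(hcoef m hm).1, fun t => ?_⟩
      rw [← (hcoef m hm).2 t]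
      exact Int.natCast_nonneg _
    rw [countOn, this]
    simp

/-- The roots outside the basis are added one at a time, each raising the degree bound by one;
uniqueness of ray sums identifies the new partition function with the member of the span just
constructed. -/
theorem countOn_mem_coneSpan (B : Frame Φ ι) {ξ : Fin n → ℝ} (hξ : IsSmallGeneric ξ)
    (hB : ∀ t, 0 < rform (B.form t) ξ) (h : Fin n → ℤ) (hh : ∀ e ∈ Φ, 0 < h ⬝ᵥ root e) :
    countOn Φ ∈ coneSpan Φ ι ξ (#Φ - Fintype.card ι) := by
  have hsub : univ.image B.edge ⊆ Φ := by
    intro e he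
    obtain ⟨t, -, rfl⟩ := mem_image.1 he
    exact B.mem t
  have key : ∀ T ⊆ Φ \ univ.image B.edge,
      countOn (T ∪ univ.image B.edge) ∈ coneSpan Φ ι ξ #T := by
    intro T
    induction T using Finset.induction_on with
    | empty =>
      intro _
      rw [empty_union, countOn_frame B hξ hB]
      exact Submodule.subset_span ⟨B, 1, by simp, rfl⟩
    | insert β T hβ ih =>
      intro hT
      have hT' : T ⊆ Φ \ univ.image B.edge := (subset_insert _ _).trans hT
      have hβ' := mem_sdiff.1 (hT (mem_insert_self _ _))
      obtain ⟨f', h1, h2⟩ := exists_isRaySum_of_mem_coneSpan hξ h hh hβ'.1 (ih hT')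
      rw [card_insert_of_notMem hβ, insert_union]
      have h3 : IsRaySum (root β) (countOn (T ∪ univ.image B.edge))
          (countOn (insert β (T ∪ univ.image B.edge))) := by
        refine isRaySum_countOn (h := h) (by simp only [mem_union, not_or]; exact ⟨hβ, hβ'.2⟩) ?_
        intro e he
        refine hh e ?_
        rcases mem_insert.1 he with rfl | he
        · exact hβ'.1
        · rcases mem_union.1 he with he | he
          · exact (mem_sdiff.1 (hT' he)).1
          · exact hsub he
      rw [h3.unique h2]
      exact h1
  have := key _ subset_rfl
  rwa [sdiff_union_of_subset hsub, card_sdiff_of_subset hsub,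
    card_image_of_injective _ B.edge_injective, card_univ] at this

end ParabolicKostant

/-! ### A basis of roots whose cone contains a given generic vector -/

namespace ParabolicKostant

open Finset

variable {n : ℕ}

/-- The edges of a directed tree on the vertices `A` along which the level increases, given
algebraically by coordinate forms, such that the flow with net outflow `w` is positive. -/
structure IsFlowTree (lev : Fin n → ℕ) (A : Finset (Fin n)) (w : Fin n → ℝ) {k : ℕ}
    (edge : Fin k → Fin n × Fin n) (form : Fin k → Fin n → ℤ) : Prop where
  fst_mem : ∀ t, (edge t).1 ∈ A
  snd_mem : ∀ t, (edge t).2 ∈ A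
  lev_lt : ∀ t, lev (edge t).1 < lev (edge t).2
  dual : ∀ s t, form s ⬝ᵥ root (edge t) = if s = t then 1 else 0
  expand : ∀ γ : Fin n → ℤ, (∀ i ∉ A, γ i = 0) → ∑ i, γ i = 0 →
    ∑ t, (form t ⬝ᵥ γ) • root (edge t) = γ
  pos : ∀ t, 0 < rform (form t) w

/-- Move the weight at `x` to `y`. -/
noncomputable def moveWeight (w : Fin n → ℝ) (x y : Fin n) : Fin n → ℝ :=
  fun i => w i - w x * (root (x, y) i : ℤ)

theorem sum_moveWeight (w : Fin n → ℝ) {x y : Fin n} {S : Finset (Fin n)} (hx : x ∉ S) :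
    ∑ i ∈ S, moveWeight w x y i = if y ∈ S then ∑ i ∈ insert x S, w i else ∑ i ∈ S, w i := by
  rw [sum_insert hx]
  simp only [moveWeight, root, Finset.sum_sub_distrib, ← Finset.mul_sum, Pi.sub_apply]
  push_cast
  simp only [Finset.sum_sub_distrib, Pi.single_apply]
  push_cast
  rw [Finset.sum_ite_eq', Finset.sum_ite_eq', if_neg hx]
  split_ifs <;> ring

theorem rform_moveWeight (l : Fin n → ℤ) (w : Fin n → ℝ) (x y : Fin n) :
    rform l (moveWeight w x y) = rform l w - (l ⬝ᵥ root (x, y) : ℤ) * w x := by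
  rw [← rform_intCast]
  simp only [rform, moveWeight, Finset.sum_mul, ← Finset.sum_sub_distrib]
  exact Finset.sum_congr rfl fun i _ => by ring

/-- Attaches `x` to `y` as a leaf: the new edge must carry the whole weight of `x`, and the rest of
the flow lives on the smaller tree. The sign `s` records the direction of the edge. -/
theorem IsFlowTree.exists_cons {lev : Fin n → ℕ} {A : Finset (Fin n)} {w : Fin n → ℝ} {k : ℕ}
    {x y : Fin n} (hx : x ∈ A) (hy : y ∈ A) (hxy : x ≠ y) {edge : Fin k → Fin n × Fin n}
    {form : Fin k → Fin n → ℤ} (hT : IsFlowTree lev (A.erase x) (moveWeight w x y) edge form)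
    (e : Fin n × Fin n) (s : ℤ) (he : root e = s • root (x, y)) (hs : s * s = 1)
    (he1 : e.1 ∈ A) (he2 : e.2 ∈ A) (hlev : lev e.1 < lev e.2) (hpos : 0 < s * w x) :
    ∃ (edge' : Fin (k + 1) → Fin n × Fin n) (form' : Fin (k + 1) → Fin n → ℤ),
      IsFlowTree lev A w edge' form' := by
  have hrx : ∀ t, root (edge t) x = 0 := by
    intro t
    have h1 : x ≠ (edge t).1 := fun h => notMem_erase x A (by have := hT.fst_mem t; rwa [← h] at this)
    have h2 : x ≠ (edge t).2 := fun h => notMem_erase x A (by have := hT.snd_mem t; rwa [← h] at this)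
    simp [root, h1, h2]
  have hrxy : root (x, y) x = 1 := by simp [root, hxy]
  have hrxy' : ∀ γ : Fin n → ℤ, (Pi.single x 1 : Fin n → ℤ) ⬝ᵥ γ = γ x := fun γ => by simp
  refine ⟨Fin.cons e edge, Fin.cons (s • Pi.single x 1)
    fun t => form t - (form t ⬝ᵥ root (x, y)) • Pi.single x 1, ⟨?_, ?_, ?_, ?_, ?_, ?_⟩⟩
  · intro t
    refine Fin.cases he1 (fun t => mem_of_mem_erase (hT.fst_mem t)) t
  · intro t
    refine Fin.cases he2 (fun t => mem_of_mem_erase (hT.snd_mem t)) t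
  · intro t
    refine Fin.cases hlev (fun t => hT.lev_lt t) t
  · intro a b
    induction a using Fin.cases with
    | zero =>
      induction b using Fin.cases with
      | zero =>
        simp only [Fin.cons_zero, smul_dotProduct, he, hrxy', Pi.smul_apply, smul_eq_mul, hrxy]
        simp [hs]
      | succ b =>
        simp only [Fin.cons_zero, Fin.cons_succ, smul_dotProduct, hrxy', hrx]
        simp [(Fin.succ_ne_zero b).symm]
    | succ a =>
      induction b using Fin.cases with
      | zero =>
        simp only [Fin.cons_zero, Fin.cons_succ, sub_dotProduct, smul_dotProduct, hrxy', he,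
          dotProduct_smul, smul_eq_mul, hrxy, Fin.succ_ne_zero, if_false]
        ring
      | succ b =>
        simp only [Fin.cons_succ, sub_dotProduct, smul_dotProduct, hrxy', hrx, hT.dual,
          Fin.succ_inj]
        simp
  · intro γ hA h0
    rw [Fin.sum_univ_succ]
    simp only [Fin.cons_zero, Fin.cons_succ, sub_dotProduct, smul_dotProduct, hrxy']
    have h1 := hT.expand (γ - γ x • root (x, y)) ?_ ?_
    · simp only [dotProduct_sub, dotProduct_smul] at h1
      have h2 : ∀ t, (form t ⬝ᵥ root (x, y)) • γ x = γ x • (form t ⬝ᵥ root (x, y)) := by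
        intro t; simp only [smul_eq_mul, mul_comm]
      simp only [h2]
      rw [h1, he, smul_smul, smul_eq_mul]
      rw [show s * γ x * s = γ x by linear_combination (γ x) * hs]
      abel
    · intro i hi
      by_cases hix : i = x
      · subst hix
        simp [hrxy]
      · have hiA : i ∉ A := fun h => hi (mem_erase.2 ⟨hix, h⟩)
        have hiy : i ≠ y := by rintro rfl; exact hiA hy
        simp [hA i hiA, root, hix, hiy]
    · simp only [Pi.sub_apply, Pi.smul_apply, smul_eq_mul, Finset.sum_sub_distrib,
        ← Finset.mul_sum, sum_root, h0]
      simp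
  · intro t
    have hsingle : rform (Pi.single x 1 : Fin n → ℤ) w = w x := by
      simp [rform, Pi.single_apply]
    induction t using Fin.cases with
    | zero =>
      rw [Fin.cons_zero, rform_zsmul, hsingle]
      exact hpos
    | succ t =>
      rw [Fin.cons_succ, rform_sub_smul, hsingle, ← rform_moveWeight]
      exact hT.pos t

/-- A sink `j` of lowest level has a source `i` strictly below it, since otherwise `{j}` would be
closed under lower levels with negative weight. Send flow from `i` to `j` until one of them is used
up, detach that one as a leaf and recurse. -/
theorem exists_isFlowTree (lev : Fin n → ℕ) (k : ℕ) : ∀ (A : Finset (Fin n)) (w : Fin n → ℝ),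
    #A = k + 1 → ∑ i ∈ A, w i = 0 →
    (∀ S ⊆ A, S ≠ ∅ → S ≠ A → ∑ i ∈ S, w i ≠ 0) →
    (∀ U ⊆ A, (∀ u ∈ U, ∀ v ∈ A, lev v < lev u → v ∈ U) → 0 ≤ ∑ i ∈ U, w i) →
    ∃ (edge : Fin k → Fin n × Fin n) (form : Fin k → Fin n → ℤ), IsFlowTree lev A w edge form := by
  induction k with
  | zero =>
    intro A w hA _ _ _
    refine ⟨Fin.elim0, Fin.elim0, ⟨fun t => t.elim0, fun t => t.elim0, fun t => t.elim0,
      fun t => t.elim0, ?_, fun t => t.elim0⟩⟩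
    intro γ hγ h0
    obtain ⟨a, rfl⟩ := card_eq_one.1 hA
    have h1 : ∀ i, i ≠ a → γ i = 0 := fun i hi => hγ i (by simpa using hi)
    rw [Fintype.sum_eq_single a h1] at h0
    funext i
    by_cases hi : i = a
    · rw [hi, h0]; simp
    · rw [h1 i hi]; simp
  | succ k ih =>
    intro A w hA h0 hgen hup
    have hne : ∀ i ∈ A, w i ≠ 0 := by
      intro i hi
      have := hgen {i} (by simpa using hi) (by simp) (by rintro rfl; simp at hA)
      simpa using this
    have hneg : ∃ j ∈ A, w j < 0 := by
      by_contra! hcon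
      obtain ⟨i, hi⟩ : A.Nonempty := card_pos.1 (by omega)
      have h1 : 0 < w i := lt_of_le_of_ne (hcon i hi) (hne i hi).symm
      have := Finset.single_le_sum hcon hi
      linarith
    obtain ⟨j, hj, hjmin⟩ := Finset.exists_min_image (A.filter fun i => w i < 0) lev
      (by obtain ⟨j, h1, h2⟩ := hneg; exact ⟨j, by simp [h1, h2]⟩)
    rw [mem_filter] at hj
    obtain ⟨hjA, hwj⟩ := hj
    have hlow : ∀ i ∈ A, lev i < lev j → 0 < w i := by
      intro i hi hij
      by_contra hcon
      have := hjmin i (mem_filter.2 ⟨hi, lt_of_le_of_ne (not_lt.1 hcon) (hne i hi)⟩)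
      omega
    obtain ⟨i, hiA, hij⟩ : ∃ i ∈ A, lev i < lev j := by
      by_contra! hcon
      have := hup {j} (by simpa using hjA) (by
        intro u hu v hv huv
        rw [mem_singleton] at hu
        subst hu
        have := hcon v hv
        omega)
      simp at this
      linarith
    have hwi := hlow i hiA hij
    have hne_ij : i ≠ j := by rintro rfl; omega
    have hgen' : ∀ x ∈ A, ∀ y ∈ A, x ≠ y → ∀ S ⊆ A.erase x, S ≠ ∅ → S ≠ A.erase x →
        ∑ a ∈ S, moveWeight w x y a ≠ 0 := by
      intro x hx y hy hxy S hS hS1 hS2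
      have hxS : x ∉ S := fun h => notMem_erase x A (hS h)
      have hSA : S ⊆ A := hS.trans (erase_subset _ _)
      rw [sum_moveWeight w hxS]
      split_ifs with hyS
      · refine hgen _ (insert_subset hx hSA) (by simp) ?_
        rintro rfl
        exact hS2 (erase_insert hxS).symm
      · exact hgen _ hSA hS1 (by rintro rfl; exact hxS hx)
    have h0' : ∀ x ∈ A, ∀ y ∈ A, x ≠ y → ∑ a ∈ A.erase x, moveWeight w x y a = 0 := by
      intro x hx y hy hxy
      rw [sum_moveWeight w (notMem_erase x A), if_pos (mem_erase.2 ⟨hxy.symm, hy⟩),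
        insert_erase hx, h0]
    rcases le_or_gt (w i + w j) 0 with hle | hgt
    · -- the source `i` is used up
      obtain ⟨edge, form, hT⟩ := ih (A.erase i) (moveWeight w i j)
        (by rw [card_erase_of_mem hiA, hA]; rfl) (h0' i hiA j hjA hne_ij)
        (hgen' i hiA j hjA hne_ij) (by
          intro U hU hUp
          have hiU : i ∉ U := fun h => notMem_erase i A (hU h)
          have hUA : U ⊆ A := hU.trans (erase_subset _ _)
          rw [sum_moveWeight w hiU]
          split_ifs with hjU
          · refine hup _ (insert_subset hiA hUA) ?_
            intro u hu v hv huv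
            by_cases hvi : v = i
            · exact hvi ▸ mem_insert_self _ _
            refine mem_insert_of_mem ?_
            rcases mem_insert.1 hu with rfl | hu
            · exact hUp j hjU v (mem_erase.2 ⟨hvi, hv⟩) (by omega)
            · exact hUp u hu v (mem_erase.2 ⟨hvi, hv⟩) huv
          -- As `j ∉ U`, nothing in `U` lies above `j`; a sink in `U` lies no lower than `j`. So if
          -- there is one, `U ∪ {i, j}` is closed under lower levels, and `w i + w j ≤ 0` gives the
          -- bound.
          · by_cases hU0 : ∀ u ∈ U, 0 ≤ w u
            · exact Finset.sum_nonneg hU0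
            push Not at hU0
            obtain ⟨u₀, hu₀, hwu₀⟩ := hU0
            have hlu₀ := hjmin u₀ (mem_filter.2 ⟨hUA hu₀, hwu₀⟩)
            have hUj : ∀ u ∈ U, lev u ≤ lev j := by
              intro u hu
              by_contra hcon
              exact hjU (hUp u hu j (mem_erase.2 ⟨hne_ij.symm, hjA⟩) (by omega))
            have h2 := hup (insert i (insert j U))
              (insert_subset hiA (insert_subset hjA hUA)) (by
                intro u hu v hv huv
                have huj : lev u ≤ lev j := by
                  rcases mem_insert.1 hu with rfl | hu
                  · exact hij.le
                  rcases mem_insert.1 hu with rfl | hu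
                  · exact le_rfl
                  · exact hUj u hu
                by_cases hvi : v = i
                · exact hvi ▸ mem_insert_self _ _
                exact mem_insert_of_mem (mem_insert_of_mem
                  (hUp u₀ hu₀ v (mem_erase.2 ⟨hvi, hv⟩) (by omega))))
            rw [sum_insert (by simp [hne_ij, hiU]), sum_insert hjU] at h2
            linarith)
      exact hT.exists_cons hiA hjA hne_ij (i, j) 1 (by simp) rfl hiA hjA hij (by simpa using hwi)
    · -- the sink `j` is used up
      obtain ⟨edge, form, hT⟩ := ih (A.erase j) (moveWeight w j i)
        (by rw [card_erase_of_mem hjA, hA]; rfl) (h0' j hjA i hiA hne_ij.symm)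
        (hgen' j hjA i hiA hne_ij.symm) (by
          intro U hU hUp
          have hjU : j ∉ U := fun h => notMem_erase j A (hU h)
          have hUA : U ⊆ A := hU.trans (erase_subset _ _)
          rw [sum_moveWeight w hjU]
          -- If `U` misses some position below `j`, then all of `U` lies below `j`, where weights
          -- are positive.
          by_cases hall : ∀ v ∈ A, lev v < lev j → v ∈ U
          · rw [if_pos (hall i hiA hij)]
            refine hup _ (insert_subset hjA hUA) ?_
            intro u hu v hv huv
            by_cases hvj : v = j
            · exact hvj ▸ mem_insert_self _ _
            refine mem_insert_of_mem ?_
            rcases mem_insert.1 hu with rfl | hu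
            · exact hall v hv huv
            · exact hUp u hu v (mem_erase.2 ⟨hvj, hv⟩) huv
          · push Not at hall
            obtain ⟨v, hv, hvj, hvU⟩ := hall
            have hUlow : ∀ u ∈ U, 0 < w u := by
              intro u hu
              refine hlow u (hUA hu) ?_
              by_contra hcon
              exact hvU (hUp u hu v (mem_erase.2 ⟨by rintro rfl; omega, hv⟩) (by omega))
            split_ifs with hiU
            · rw [sum_insert hjU, ← add_sum_erase U w hiU]
              have : 0 ≤ ∑ u ∈ U.erase i, w u :=
                Finset.sum_nonneg fun u hu => (hUlow u (mem_of_mem_erase hu)).le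
              linarith
            · exact Finset.sum_nonneg fun u hu => (hUlow u hu).le)
      refine hT.exists_cons hjA hiA hne_ij.symm (i, j) (-1) ?_ rfl hiA hjA hij ?_
      · simp [root]
      · push_cast
        linarith

theorem exists_frame_pos (lev : Fin n → ℕ) {k : ℕ} (hn : n = k + 1) {ξ : Fin n → ℝ}
    (h0 : ∑ i, ξ i = 0) (hgen : ∀ S : Finset (Fin n), S ≠ ∅ → S ≠ univ → ∑ i ∈ S, ξ i ≠ 0)
    (hup : ∀ U : Finset (Fin n), (∀ u ∈ U, ∀ v, lev v < lev u → v ∈ U) → 0 ≤ ∑ i ∈ U, ξ i) :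
    ∃ B : Frame (univ.filter fun e : Fin n × Fin n => lev e.1 < lev e.2) (Fin k),
      ∀ t, 0 < rform (B.form t) ξ := by
  obtain ⟨edge, form, hT⟩ := exists_isFlowTree lev k univ ξ (by simp [hn]) h0
    (fun S _ => hgen S) (fun U _ hU => hup U fun u hu v huv => hU u hu v (mem_univ v) huv)
  exact ⟨⟨edge, form, fun t => by simpa using hT.lev_lt t, hT.dual,
    fun γ hγ => hT.expand γ (by simp) hγ⟩, hT.pos⟩

end ParabolicKostant

/-! ### From lattice points to real points of a rational cone -/

namespace ParabolicKostant

open Finset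

variable {n : ℕ}

/-- With `M` a common denominator, all `j * M * y` are lattice points of the cone, so `Q` has
infinitely many zeros on the line through `y`. -/
theorem eval_rat_eq_zero {Q : MvPolynomial (Fin n) ℚ} {A : Finset (Fin n → ℤ)}
    (hQ : ∀ γ : Fin n → ℤ, (∀ a ∈ A, 0 ≤ a ⬝ᵥ γ) → evalZ Q γ = 0) (y : Fin n → ℚ)
    (hy : ∀ a ∈ A, 0 ≤ ∑ i, (a i : ℚ) * y i) : MvPolynomial.eval y Q = 0 := by
  set M : ℕ := ∏ i, (y i).den with hM
  have hMpos : 0 < M := Finset.prod_pos fun i _ => (y i).den_pos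
  have hint : ∀ i, ∃ z : ℤ, (z : ℚ) = M * y i := by
    intro i
    obtain ⟨c, hc⟩ : (y i).den ∣ M := Finset.dvd_prod_of_mem _ (mem_univ i)
    refine ⟨c * (y i).num, ?_⟩
    rw [hc]
    push_cast
    have := Rat.den_mul_eq_num (y i)
    rw [← this]
    ring
  choose z hz using hint
  set R : Polynomial ℚ :=
    MvPolynomial.aeval (fun i => Polynomial.C (y i) * Polynomial.X) Q with hR
  have hReval : ∀ r : ℚ, R.eval r = MvPolynomial.eval (fun i => y i * r) Q := by
    intro r
    rw [hR]
    clear hR R hQ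
    induction Q using MvPolynomial.induction_on with
    | C c => simp
    | add p q hp hq => simp [hp, hq]
    | mul_X p i hp => simp [hp]
  have hroot : ∀ j : ℕ, R.eval ((j * M : ℕ) : ℚ) = 0 := by
    intro j
    rw [hReval]
    have h1 := hQ (fun i => j * z i) ?_
    · rw [← h1, evalZ]
      congr 2
      funext i
      push_cast
      rw [hz]
      ring
    · intro a ha
      have h2 := hy a ha
      have h3 : ((a ⬝ᵥ (fun i => (j : ℤ) * z i) : ℤ) : ℚ) = j * M * ∑ i, (a i : ℚ) * y i := by
        simp only [dotProduct]
        push_cast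
        rw [Finset.mul_sum]
        refine Finset.sum_congr rfl fun i _ => ?_
        rw [hz]
        ring
      have h4 : (0 : ℚ) ≤ ((a ⬝ᵥ (fun i => (j : ℤ) * z i) : ℤ) : ℚ) := by
        rw [h3]; positivity
      exact_mod_cast h4
  have hR0 : R = 0 := by
    refine Polynomial.eq_zero_of_infinite_isRoot R ?_
    refine Set.infinite_of_injective_forall_mem (f := fun j : ℕ => ((j * M : ℕ) : ℚ)) ?_ hroot
    intro i j hij
    simp only at hij
    exact Nat.eq_of_mul_eq_mul_right hMpos (by exact_mod_cast hij)
  have := hReval 1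
  rw [hR0] at this
  simpa using this.symm

/-- Take a `ℚ`-basis of the span of the entries of `x`: by independence, an integral relation
between the entries holds for every coefficient vector. Varying the parameters `t` thus moves `x`
without breaking any of its integral relations. -/
theorem exists_rational_coordinates (x : Fin n → ℝ) :
    ∃ (k : ℕ) (t : Fin k → ℝ) (q : Fin k → Fin n → ℚ),
      (∀ i, x i = ∑ j, (q j i : ℝ) * t j) ∧
      ∀ a : Fin n → ℤ, ∑ i, (a i : ℝ) * x i = 0 → ∀ j, ∑ i, (a i : ℚ) * q j i = 0 := by
  set W : Submodule ℚ ℝ := Submodule.span ℚ (Set.range x)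
  have : FiniteDimensional ℚ W := FiniteDimensional.span_of_finite ℚ (Set.finite_range x)
  set b := Module.finBasis ℚ W
  have hx : ∀ i, x i ∈ W := fun i => Submodule.subset_span ⟨i, rfl⟩
  have hrepr : ∀ i, x i = ∑ j, ((b.repr ⟨x i, hx i⟩ j : ℚ) : ℝ) * (b j : ℝ) := by
    intro i
    have h1 := b.sum_repr ⟨x i, hx i⟩
    have h2 := congrArg (Submodule.subtype W) h1
    rw [map_sum] at h2
    simp only [map_smul, Submodule.subtype_apply, Rat.smul_def] at h2
    exact h2.symm
  refine ⟨Module.finrank ℚ W, fun j => (b j : ℝ), fun j i => b.repr ⟨x i, hx i⟩ j, hrepr, ?_⟩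
  intro a ha
  have hli : LinearIndependent ℚ fun j => (b j : ℝ) :=
    b.linearIndependent.map' (Submodule.subtype W) (Submodule.ker_subtype W)
  rw [Fintype.linearIndependent_iff] at hli
  refine hli (fun j => ∑ i, (a i : ℚ) * b.repr ⟨x i, hx i⟩ j) ?_
  rw [← ha]
  simp only [Rat.smul_def]
  push_cast
  simp only [Finset.sum_mul]
  rw [Finset.sum_comm]
  refine Finset.sum_congr rfl fun i _ => ?_
  conv_rhs => rw [hrepr i]
  rw [Finset.mul_sum]
  exact Finset.sum_congr rfl fun j _ => by ring

/-- The cone may have empty interior, so `x` is approximated by varying only the parameters `t`: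
constraints that are equalities at `x` persist identically, strict ones persist nearby. `Q` vanishes
at the rational points reached, hence at `x` by continuity. -/
theorem aeval_eq_zero_of_cone {Q : MvPolynomial (Fin n) ℚ} {A : Finset (Fin n → ℤ)}
    (hQ : ∀ γ : Fin n → ℤ, (∀ a ∈ A, 0 ≤ a ⬝ᵥ γ) → evalZ Q γ = 0) (x : Fin n → ℝ)
    (hx : ∀ a ∈ A, 0 ≤ ∑ i, (a i : ℝ) * x i) : MvPolynomial.aeval x Q = 0 := by
  obtain ⟨k, t, q, hxt, hq⟩ := exists_rational_coordinates x
  set y : (Fin k → ℝ) → Fin n → ℝ := fun s i => ∑ j, (q j i : ℝ) * s j with hy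
  have hyt : y t = x := by funext i; exact (hxt i).symm
  have hycont : Continuous y := by fun_prop
  have hcone : ∀ᶠ s in nhds t, ∀ a ∈ A, 0 ≤ ∑ i, (a i : ℝ) * y s i := by
    rw [Filter.eventually_all_finset]
    intro a ha
    rcases (hx a ha).eq_or_lt with h | h
    · refine Filter.Eventually.of_forall fun s => le_of_eq ?_
      have h1 := hq a h.symm
      simp only [hy, Finset.mul_sum]
      rw [Finset.sum_comm]
      refine (Finset.sum_eq_zero fun j _ => ?_).symm
      have h2 : ((∑ i, (a i : ℚ) * q j i : ℚ) : ℝ) = 0 := by rw [h1 j]; simp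
      push_cast at h2
      rw [← zero_mul (s j), ← h2, Finset.sum_mul]
      exact Finset.sum_congr rfl fun i _ => by ring
    · have hc : Continuous fun s => ∑ i, (a i : ℝ) * y s i := by fun_prop
      have := (hc.tendsto t).eventually_const_lt (u := 0) (by rw [hyt]; exact h)
      exact this.mono fun s hs => hs.le
  have hf : Continuous fun s => MvPolynomial.aeval (y s) Q := by
    have := (MvPolynomial.continuous_eval (MvPolynomial.map (algebraMap ℚ ℝ) Q)).comp hycont
    simpa [Function.comp_def, MvPolynomial.aeval_def, MvPolynomial.eval_map] using this
  by_contra hne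
  rw [← hyt] at hne
  have hev : ∀ᶠ s in nhds t, MvPolynomial.aeval (y s) Q ≠ 0 := hf.continuousAt.eventually_ne hne
  have hdense : DenseRange fun (r : Fin k → ℚ) (j : Fin k) => (r j : ℝ) :=
    DenseRange.piMap fun _ => Rat.denseRange_cast
  obtain ⟨U, hU, hUo, htU⟩ := eventually_nhds_iff.1 (hcone.and hev)
  obtain ⟨r, hr⟩ := hdense.exists_mem_open hUo ⟨t, htU⟩
  obtain ⟨h1, h2⟩ := hU _ hr
  apply h2
  have hyr : (y fun j => (r j : ℝ)) = fun i => ((∑ j, q j i * r j : ℚ) : ℝ) := by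
    funext i; simp [hy]
  have h3 := eval_rat_eq_zero hQ (fun i => ∑ j, q j i * r j) (by
    intro a ha
    have := h1 a ha
    rw [hyr] at this
    simp only at this
    exact_mod_cast this)
  rw [hyr]
  have h4 := MvPolynomial.aeval_algebraMap_apply ℝ (fun i => ∑ j, q j i * r j) Q
  have h5 : (MvPolynomial.aeval (fun i => ∑ j, q j i * r j)) Q = (0 : ℚ) := by
    simpa [MvPolynomial.aeval_eq_eval] using h3
  rw [h5, map_zero] at h4
  exact h4

/-- Functions given by rational polynomials on finitely many rational cones that agree at lattice
points can be glued. -/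
theorem exists_glue {I : Type*} (A : I → Finset (Fin n → ℤ))
    (p : I → MvPolynomial (Fin n) ℚ) (K : (Fin n → ℤ) → ℚ)
    (hK : ∀ s γ, (∀ a ∈ A s, 0 ≤ a ⬝ᵥ γ) → K γ = evalZ (p s) γ) :
    ∃ F : (Fin n → ℝ) → ℝ, ∀ s x, (∀ a ∈ A s, 0 ≤ ∑ i, (a i : ℝ) * x i) →
      F x = MvPolynomial.aeval x (p s) := by
  classical
  refine ⟨fun x => if h : ∃ s, ∀ a ∈ A s, 0 ≤ ∑ i, (a i : ℝ) * x i then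
    MvPolynomial.aeval x (p h.choose) else 0, fun s x hx => ?_⟩
  have h : ∃ s, ∀ a ∈ A s, 0 ≤ ∑ i, (a i : ℝ) * x i := ⟨s, hx⟩
  simp only [dif_pos h]
  rw [← sub_eq_zero, ← map_sub]
  refine aeval_eq_zero_of_cone (A := A h.choose ∪ A s) (fun γ hγ => ?_) x ?_
  · have h1 := hK h.choose γ fun a ha => hγ a (mem_union_left _ ha)
    have h2 := hK s γ fun a ha => hγ a (mem_union_right _ ha)
    have : evalZ (p h.choose - p s) γ = evalZ (p h.choose) γ - evalZ (p s) γ := by simp [evalZ]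
    rw [this, ← h1, ← h2, sub_self]
  · intro a ha
    rcases mem_union.1 ha with ha | ha
    · exact h.choose_spec a ha
    · exact hx a ha

end ParabolicKostant

/-! ### Chambers and the piecewise polynomial -/

namespace ParabolicKostant

open Finset

variable {n : ℕ}

/-- The pairs of positions along which the level increases. -/
def levRoots (lev : Fin n → ℕ) : Finset (Fin n × Fin n) :=
  univ.filter fun e => lev e.1 < lev e.2

/-- `U` contains with a position all positions of lower level. -/
def IsLevUpper (lev : Fin n → ℕ) (U : Finset (Fin n)) : Prop :=
  ∀ u ∈ U, ∀ v, lev v < lev u → v ∈ U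

/-- The vectors of coordinate sum zero with non-negative sums over all sets that are closed
under passing to lower levels. -/
def levCone (lev : Fin n → ℕ) : Set (Fin n → ℝ) :=
  {x | ∑ i, x i = 0 ∧ ∀ U, IsLevUpper lev U → 0 ≤ ∑ i ∈ U, x i}

theorem levRoots_height (lev : Fin n → ℕ) (e : Fin n × Fin n) (he : e ∈ levRoots lev) :
    0 < (fun i => -(lev i : ℤ)) ⬝ᵥ root e := by
  rw [dotProduct_root]
  simp only [levRoots, mem_filter, mem_univ, true_and] at he
  omega

/-- The subsets over which `ξ` has a positive sum. -/
noncomputable def posSets (ξ : Fin n → ℝ) : Finset (Finset (Fin n)) := by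
  classical exact univ.filter fun S => 0 < ∑ i ∈ S, ξ i

theorem mem_posSets {ξ : Fin n → ℝ} {S : Finset (Fin n)} :
    S ∈ posSets ξ ↔ 0 < ∑ i ∈ S, ξ i := by
  simp [posSets]

/-- The indicator vector of a set. -/
def indicatorForm (S : Finset (Fin n)) : Fin n → ℤ := fun i => if i ∈ S then 1 else 0

theorem sum_indicatorForm_mul {R : Type*} [CommRing R] (S : Finset (Fin n)) (x : Fin n → R) :
    ∑ i, (indicatorForm S i : R) * x i = ∑ i ∈ S, x i := by
  simp [indicatorForm, Finset.sum_ite_mem]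

/-- The linear forms defining the closed chamber with positive subset sums `σ`. -/
def chamberForms (σ : Finset (Finset (Fin n))) : Finset (Fin n → ℤ) :=
  insert (indicatorForm univ) (insert (-indicatorForm univ) (σ.image indicatorForm))

theorem forall_chamberForms {R : Type*} [CommRing R] [LinearOrder R] [IsStrictOrderedRing R]
    (σ : Finset (Finset (Fin n))) (x : Fin n → R) :
    (∀ a ∈ chamberForms σ, 0 ≤ ∑ i, (a i : R) * x i) ↔
      ∑ i, x i = 0 ∧ ∀ S ∈ σ, 0 ≤ ∑ i ∈ S, x i := by
  have hneg : ∑ i, ((-indicatorForm (univ : Finset (Fin n))) i : R) * x i = -∑ i, x i := by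
    rw [← sum_indicatorForm_mul univ x, ← Finset.sum_neg_distrib]
    exact Finset.sum_congr rfl fun i _ => by simp
  simp only [chamberForms, mem_insert, mem_image, forall_eq_or_imp, forall_exists_index, and_imp,
    forall_apply_eq_imp_iff₂, sum_indicatorForm_mul, hneg]
  constructor
  · rintro ⟨h1, h2, h3⟩
    exact ⟨le_antisymm (by linarith) h1, h3⟩
  · rintro ⟨h1, h3⟩
    exact ⟨h1.ge, by simp [h1], h3⟩

theorem forall_chamberForms_int (σ : Finset (Finset (Fin n))) (γ : Fin n → ℤ) :
    (∀ a ∈ chamberForms σ, 0 ≤ a ⬝ᵥ γ) ↔ ∑ i, γ i = 0 ∧ ∀ S ∈ σ, 0 ≤ ∑ i ∈ S, γ i := by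
  rw [← forall_chamberForms]
  simp [dotProduct]

theorem exists_chamber_poly (lev : Fin n → ℕ) {k : ℕ} (hn : n = k + 1) {ξ : Fin n → ℝ}
    (hξ : IsSmallGeneric ξ) (hξY : ξ ∈ levCone lev) :
    ∃ P : MvPolynomial (Fin n) ℚ, P.totalDegree ≤ #(levRoots lev) - k ∧
      ∀ γ : Fin n → ℤ, (∀ a ∈ chamberForms (posSets ξ), 0 ≤ a ⬝ᵥ γ) →
        countOn (levRoots lev) γ = evalZ P γ := by
  obtain ⟨B, hB⟩ := exists_frame_pos lev hn hξ.sum_eq_zero hξ.sum_ne_zero hξY.2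
  have h1 := countOn_mem_coneSpan B hξ hB _ (levRoots_height lev)
  rw [Fintype.card_fin] at h1
  obtain ⟨P, h2, h3⟩ := exists_poly_of_mem_coneSpan hξ h1
  refine ⟨P, h2, fun γ hγ => ?_⟩
  rw [forall_chamberForms_int] at hγ
  exact h3 γ hγ.1 fun S hS => hγ.2 S (mem_posSets.2 hS)

/-- The hypothesis on the levels is essential: with a single level and `n ≥ 2` the cone is `{0}`,
which has no generic point. -/
theorem exists_generic_mem_levCone (lev : Fin n → ℕ)
    (hlev : ((∃ i, lev i = 0) ∧ ∃ j, lev j ≠ 0) ∨ n = 1) :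
    ∃ y ∈ levCone lev, ∀ S : Finset (Fin n), S ≠ ∅ → S ≠ univ → ∑ i ∈ S, y i ≠ 0 := by
  rcases hlev with ⟨⟨i₀, hi₀⟩, j₀, hj₀⟩ | rfl
  swap
  · refine ⟨0, ⟨by simp, fun U _ => by simp⟩, fun S h1 h2 => ?_⟩
    obtain ⟨a, ha⟩ := Finset.nonempty_iff_ne_empty.2 h1
    exact absurd (Finset.eq_univ_iff_forall.2 fun b => Subsingleton.elim a b ▸ ha) h2
  -- The entry at `i₀` balances the total. A sum over a set without `i₀` is `a - n * b`, where `a <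
  -- n` counts positions of level zero and `b` the others, so it vanishes only for the empty set;
  -- sets with `i₀` are handled by complements.
  set y₁ : Fin n → ℤ := fun i => if lev i = 0 then 1 else -(n : ℤ) with hy₁
  set c : ℤ := ∑ i ∈ univ.erase i₀, y₁ i with hc
  set y : Fin n → ℤ := fun i => if i = i₀ then -c else y₁ i with hy
  have hy_ne : ∀ i, i ≠ i₀ → y i = y₁ i := fun i hi => by simp [hy, hi]
  have h0 : ∑ i, y i = 0 := by
    rw [← Finset.add_sum_erase univ y (mem_univ i₀),
      Finset.sum_congr rfl fun i hi => hy_ne i (ne_of_mem_erase hi)]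
    simp [hy, hc]
  have hsum : ∀ S : Finset (Fin n), i₀ ∉ S →
      ∑ i ∈ S, y i = #(S.filter fun i => lev i = 0) - n * #(S.filter fun i => ¬ lev i = 0) := by
    intro S hS
    rw [Finset.sum_congr rfl fun i hi => hy_ne i (by rintro rfl; exact hS hi)]
    simp only [hy₁]
    rw [Finset.sum_ite]
    simp
    ring
  have hsmall : ∀ S : Finset (Fin n), i₀ ∉ S → #(S.filter fun i => lev i = 0) < n := by
    intro S hS
    have : (S.filter fun i => lev i = 0) ⊂ univ := by
      refine Finset.ssubset_univ_iff.2 fun h => ?_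
      have := mem_univ i₀
      rw [← h] at this
      exact hS (mem_filter.1 this).1
    simpa using card_lt_card this
  have hgen : ∀ S : Finset (Fin n), i₀ ∉ S → ∑ i ∈ S, y i = 0 → S = ∅ := by
    intro S hS h
    rw [hsum S hS] at h
    have h1 := hsmall S hS
    have h2 : #(S.filter fun i => ¬ lev i = 0) = 0 := by
      by_contra hne
      have h3 : (n : ℤ) * 1 ≤ n * #(S.filter fun i => ¬ lev i = 0) := by
        refine mul_le_mul_of_nonneg_left ?_ (Int.natCast_nonneg _)
        exact_mod_cast Nat.one_le_iff_ne_zero.2 hne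
      omega
    rw [h2] at h
    have h4 : #(S.filter fun i => lev i = 0) = 0 := by
      simp only [Nat.cast_zero, mul_zero, sub_zero] at h
      exact_mod_cast h
    have h5 := Finset.card_filter_add_card_filter_not (s := S) (fun i => lev i = 0)
    exact card_eq_zero.1 (by omega)
  have hyi₀ : 0 < y i₀ := by
    have hni : i₀ ∉ univ.erase i₀ := notMem_erase _ _
    have h1 := hsum _ hni
    rw [Finset.sum_congr rfl fun i hi => hy_ne i (ne_of_mem_erase hi), ← hc] at h1
    have h2 := hsmall _ hni
    have h3 : 1 ≤ #((univ.erase i₀).filter fun i => ¬ lev i = 0) :=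
      card_pos.2 ⟨j₀, by simp only [mem_filter, mem_erase, mem_univ, and_true]
                         exact ⟨by rintro rfl; exact hj₀ hi₀, hj₀⟩⟩
    have h4 : (n : ℤ) * 1 ≤ n * #((univ.erase i₀).filter fun i => ¬ lev i = 0) := by
      refine mul_le_mul_of_nonneg_left ?_ (Int.natCast_nonneg _)
      exact_mod_cast h3
    simp only [hy, if_true]
    omega
  have hpos : ∀ i, lev i = 0 → 0 < y i := by
    intro i hi
    by_cases h : i = i₀
    · rw [h]; exact hyi₀
    · rw [hy_ne i h]; simp [hy₁, hi]
  have hneg : ∀ i, lev i ≠ 0 → y i ≤ 0 := by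
    intro i hi
    rw [hy_ne i (by rintro rfl; exact hi hi₀)]
    simp [hy₁, hi]
  refine ⟨fun i => (y i : ℝ), ⟨by beta_reduce; exact_mod_cast h0, fun U hU => ?_⟩,
    fun S h1 h2 h3 => ?_⟩
  · suffices h : 0 ≤ ∑ i ∈ U, y i by beta_reduce; exact_mod_cast h
    by_cases hall : ∀ u ∈ U, lev u = 0
    · exact Finset.sum_nonneg fun u hu => (hpos u (hall u hu)).le
    · push Not at hall
      obtain ⟨u, hu, hu0⟩ := hall
      have h4 := Finset.sum_add_sum_compl U y
      have h5 : ∑ i ∈ Uᶜ, y i ≤ 0 := by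
        refine Finset.sum_nonpos fun v hv => hneg v fun hv0 => ?_
        exact (mem_compl.1 hv) (hU u hu v (by omega))
      linarith
  · have h3' : ∑ i ∈ S, y i = 0 := by beta_reduce at h3; exact_mod_cast h3
    by_cases hi : i₀ ∈ S
    · have h4 := Finset.sum_add_sum_compl S y
      have h5 := hgen Sᶜ (by simpa using hi) (by linarith)
      exact h2 ((compl_eq_empty_iff S).1 h5)
    · exact h1 (hgen S hi h3')

/-- Move `x` slightly in the direction of a generic point of the cone: non-zero subset sums keep
their sign, and vanishing sums over proper non-empty sets become non-zero. Scaling then makes all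
sums small. -/
theorem exists_smallGeneric_chamber (lev : Fin n → ℕ)
    (hlev : ((∃ i, lev i = 0) ∧ ∃ j, lev j ≠ 0) ∨ n = 1) {x : Fin n → ℝ} (hx : x ∈ levCone lev) :
    ∃ ξ ∈ levCone lev, IsSmallGeneric ξ ∧ ∀ S ∈ posSets ξ, 0 ≤ ∑ i ∈ S, x i := by
  obtain ⟨y, hy, hygen⟩ := exists_generic_mem_levCone lev hlev
  have hev : ∀ᶠ t : ℝ in nhdsWithin 0 (Set.Ioi 0), ∀ S : Finset (Fin n),
      (0 < ∑ i ∈ S, x i → 0 < ∑ i ∈ S, x i + t * ∑ i ∈ S, y i) ∧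
      (∑ i ∈ S, x i < 0 → ∑ i ∈ S, x i + t * ∑ i ∈ S, y i < 0) := by
    refine Filter.Eventually.filter_mono nhdsWithin_le_nhds ?_
    rw [Filter.eventually_all]
    intro S
    have hc : Continuous fun t : ℝ => ∑ i ∈ S, x i + t * ∑ i ∈ S, y i := by fun_prop
    have ht := hc.tendsto 0
    simp only [zero_mul, add_zero] at ht
    refine Filter.Eventually.and ?_ ?_
    · by_cases h : 0 < ∑ i ∈ S, x i
      · exact (ht.eventually_const_lt h).mono fun t h _ => h
      · exact Filter.Eventually.of_forall fun t h' => absurd h' h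
    · by_cases h : ∑ i ∈ S, x i < 0
      · exact (ht.eventually_lt_const h).mono fun t h _ => h
      · exact Filter.Eventually.of_forall fun t h' => absurd h' h
  obtain ⟨t, ht, ht0⟩ := (hev.and self_mem_nhdsWithin).exists
  have ht0 : 0 < t := ht0
  set z : Fin n → ℝ := fun i => x i + t * y i with hz
  have hzsum : ∀ S : Finset (Fin n), ∑ i ∈ S, z i = ∑ i ∈ S, x i + t * ∑ i ∈ S, y i := by
    intro S
    simp only [hz, Finset.sum_add_distrib, Finset.mul_sum]
  set s : ℝ := (1 + ∑ i, |z i|)⁻¹ with hs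
  have hpos : 0 < 1 + ∑ i, |z i| := by
    have : 0 ≤ ∑ i, |z i| := Finset.sum_nonneg fun i _ => abs_nonneg _
    linarith
  have hs0 : 0 < s := inv_pos.2 hpos
  have hξsum : ∀ S : Finset (Fin n), ∑ i ∈ S, s * z i = s * ∑ i ∈ S, z i :=
    fun S => (Finset.mul_sum ..).symm
  refine ⟨fun i => s * z i, ⟨?_, fun U hU => ?_⟩, ⟨?_, fun S h1 h2 => ?_, fun S => ?_⟩,
    fun S hS => ?_⟩
  · rw [hξsum, hzsum, hx.1, hy.1]; simp
  · rw [hξsum, hzsum]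
    have h1 := hx.2 U hU
    have h2 := hy.2 U hU
    positivity
  · rw [hξsum, hzsum, hx.1, hy.1]; simp
  · rw [hξsum, hzsum]
    refine mul_ne_zero hs0.ne' ?_
    rcases lt_trichotomy (∑ i ∈ S, x i) 0 with h | h | h
    · exact ((ht S).2 h).ne
    · rw [h, zero_add]
      exact mul_ne_zero ht0.ne' (hygen S h1 h2)
    · exact ((ht S).1 h).ne'
  · rw [hξsum, abs_mul, abs_of_pos hs0, hs, inv_mul_lt_iff₀ hpos, mul_one]
    have h1 : |∑ i ∈ S, z i| ≤ ∑ i ∈ S, |z i| := Finset.abs_sum_le_sum_abs _ _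
    have h2 : ∑ i ∈ S, |z i| ≤ ∑ i, |z i| :=
      Finset.sum_le_sum_of_subset_of_nonneg (subset_univ _) fun i _ _ => abs_nonneg _
    linarith
  · rw [mem_posSets, hξsum, hzsum] at hS
    by_contra hcon
    have h1 := (ht S).2 (not_le.1 hcon)
    have h2 := mul_neg_of_pos_of_neg hs0 h1
    linarith

theorem continuous_aeval_real (P : MvPolynomial (Fin n) ℚ) :
    Continuous fun x : Fin n → ℝ => MvPolynomial.aeval x P := by
  have := MvPolynomial.continuous_eval (MvPolynomial.map (algebraMap ℚ ℝ) P)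
  simpa [MvPolynomial.aeval_def, MvPolynomial.eval_map] using this

theorem isClosed_cone (A : Finset (Fin n → ℤ)) :
    IsClosed {x : Fin n → ℝ | ∀ a ∈ A, 0 ≤ ∑ i, (a i : ℝ) * x i} := by
  simp only [Set.ofPred_forall]
  refine isClosed_biInter fun a _ => ?_
  exact isClosed_le continuous_const (by fun_prop)

theorem exists_enum_posSets (lev : Fin n → ℕ) :
    ∃ (N : ℕ) (σ : Fin N → Finset (Finset (Fin n))),
      (∀ s, ∃ ξ ∈ levCone lev, IsSmallGeneric ξ ∧ posSets ξ = σ s) ∧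
      ∀ ξ ∈ levCone lev, IsSmallGeneric ξ → ∃ s, σ s = posSets ξ := by
  obtain ⟨N, ⟨e⟩⟩ := Finite.exists_equiv_fin
    {σ : Finset (Finset (Fin n)) // ∃ ξ ∈ levCone lev, IsSmallGeneric ξ ∧ posSets ξ = σ}
  exact ⟨N, fun s => (e.symm s).1, fun s => (e.symm s).2,
    fun ξ h1 h2 => ⟨e ⟨posSets ξ, ξ, h1, h2, rfl⟩, by simp⟩⟩

theorem exists_piecewise (lev : Fin n → ℕ) {k : ℕ} (hn : n = k + 1)
    (hlev : ((∃ i, lev i = 0) ∧ ∃ j, lev j ≠ 0) ∨ n = 1) :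
    ∃ F : (Fin n → ℝ) → ℝ,
      (∀ γ : Fin n → ℤ, (fun i => (γ i : ℝ)) ∈ levCone lev →
        F (fun i => (γ i : ℝ)) = (countOn (levRoots lev) γ : ℝ)) ∧
      ContinuousOn F (levCone lev) ∧
      IsPiecewisePolynomialOfDegreeLE (levCone lev) F (#(levRoots lev) - k) := by
  obtain ⟨N, σ, hσ, hσ'⟩ := exists_enum_posSets lev
  have hex : ∀ s, ∃ P : MvPolynomial (Fin n) ℚ, P.totalDegree ≤ #(levRoots lev) - k ∧
      ∀ γ : Fin n → ℤ, (∀ a ∈ chamberForms (σ s), 0 ≤ a ⬝ᵥ γ) →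
        countOn (levRoots lev) γ = evalZ P γ := by
    intro s
    obtain ⟨ξ, h1, h2, h3⟩ := hσ s
    rw [← h3]
    exact exists_chamber_poly lev hn h2 h1
  choose p hp hpK using hex
  obtain ⟨F, hF⟩ := exists_glue (fun s => chamberForms (σ s)) p (countOn (levRoots lev)) hpK
  set C : Fin N → Set (Fin n → ℝ) := fun s =>
    {x | ∀ a ∈ chamberForms (σ s), 0 ≤ ∑ i, (a i : ℝ) * x i} with hC
  have hmem : ∀ s x, x ∈ C s ↔ ∑ i, x i = 0 ∧ ∀ S ∈ σ s, 0 ≤ ∑ i ∈ S, x i :=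
    fun s x => forall_chamberForms _ x
  have hcover : levCone lev = ⋃ s, C s := by
    ext x
    rw [Set.mem_iUnion]
    constructor
    · intro hx
      obtain ⟨ξ, h1, h2, h3⟩ := exists_smallGeneric_chamber lev hlev hx
      obtain ⟨s, hs⟩ := hσ' ξ h1 h2
      exact ⟨s, (hmem s x).2 ⟨hx.1, hs ▸ h3⟩⟩
    · rintro ⟨s, hs⟩
      obtain ⟨ξ, h1, h2, h3⟩ := hσ s
      rw [hmem, ← h3] at hs
      refine ⟨hs.1, fun U hU => ?_⟩
      by_cases hU0 : U = ∅
      · simp [hU0]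
      by_cases hU1 : U = univ
      · rw [hU1, hs.1]
      -- Genericity makes the inequalities of the cone strict at `ξ`, so they are among those
      -- defining the chamber.
      refine hs.2 U (mem_posSets.2 ?_)
      exact lt_of_le_of_ne (h1.2 U hU) (h2.sum_ne_zero U hU0 hU1).symm
  refine ⟨F, fun γ hγ => ?_, ?_, N, C, p, fun s => ⟨_, rfl⟩, hcover, fun s => ⟨hp s, hF s⟩⟩
  · rw [hcover, Set.mem_iUnion] at hγ
    obtain ⟨s, hs⟩ := hγ
    rw [hF s _ hs]
    have h1 := hpK s γ (by
      intro a ha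
      have := hs a ha
      beta_reduce at this
      simp only [dotProduct]
      exact_mod_cast this)
    rw [h1]
    have h4 := MvPolynomial.aeval_algebraMap_apply ℝ (fun i => (γ i : ℚ)) (p s)
    simp only [MvPolynomial.aeval_eq_eval, eq_ratCast] at h4
    exact h4
  · rw [hcover]
    refine (locallyFinite_of_finite C).continuousOn_iUnion (fun s => isClosed_cone _) fun s => ?_
    exact (continuous_aeval_real (p s)).continuousOn.congr fun x hx => hF s x hx

end ParabolicKostant

/-! ### Lower bound for the degree -/

namespace ParabolicKostant

open Finset

variable {n : ℕ}

theorem abs_aeval_le (P : MvPolynomial (Fin n) ℚ) {d : ℕ} (hP : P.totalDegree ≤ d) :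
    ∃ c : ℝ, 0 ≤ c ∧ ∀ (x : Fin n → ℝ) (R : ℝ), 1 ≤ R → (∀ i, |x i| ≤ R) →
      |MvPolynomial.aeval x P| ≤ c * R ^ d := by
  refine ⟨∑ s ∈ P.support, |((P.coeff s : ℚ) : ℝ)|, Finset.sum_nonneg fun _ _ => abs_nonneg _,
    fun x R hR hx => ?_⟩
  rw [MvPolynomial.aeval_def, MvPolynomial.eval₂_eq, Finset.sum_mul]
  refine (Finset.abs_sum_le_sum_abs _ _).trans (Finset.sum_le_sum fun s hs => ?_)
  rw [abs_mul, Finset.abs_prod]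
  simp only [eq_ratCast]
  refine mul_le_mul_of_nonneg_left ?_ (abs_nonneg _)
  calc ∏ i ∈ s.support, |x i ^ s i| ≤ ∏ i ∈ s.support, R ^ s i := by
        refine Finset.prod_le_prod (fun _ _ => abs_nonneg _) fun i _ => ?_
        rw [abs_pow]
        exact pow_le_pow_left₀ (abs_nonneg _) (hx i) _
    _ = R ^ s.degree := by rw [Finset.prod_pow_eq_pow_sum, Finsupp.degree_apply]
    _ ≤ R ^ d := pow_le_pow_right₀ hR ((MvPolynomial.le_totalDegree hs).trans hP)

theorem abs_le_of_isPiecewisePolynomial {D : Set (Fin n → ℝ)} {F : (Fin n → ℝ) → ℝ} {d : ℕ}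
    (hF : IsPiecewisePolynomialOfDegreeLE D F d) :
    ∃ c : ℝ, 0 ≤ c ∧ ∀ x ∈ D, ∀ R : ℝ, 1 ≤ R → (∀ i, |x i| ≤ R) → |F x| ≤ c * R ^ d := by
  obtain ⟨N, C, p, -, hD, hp⟩ := hF
  choose c hc hcb using fun s => abs_aeval_le (p s) (hp s).1
  refine ⟨∑ s, c s, Finset.sum_nonneg fun s _ => hc s, fun x hx R hR hxR => ?_⟩
  rw [hD, Set.mem_iUnion] at hx
  obtain ⟨s, hs⟩ := hx
  rw [(hp s).2 x hs]
  refine (hcb s x R hR hxR).trans ?_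
  refine mul_le_mul_of_nonneg_right ?_ (by positivity)
  exact Finset.single_le_sum (fun s _ => hc s) (mem_univ s)

/-- A root has its `1` at a lower level than its `-1`, so a set closed under lower levels that
contains the second position contains the first. -/
theorem sum_smul_root_mem_levCone (lev : Fin n → ℕ) (m : Fin n × Fin n → ℕ)
    (hm : ∀ e ∉ levRoots lev, m e = 0) :
    (fun i => ((∑ e, (m e : ℤ) • root e) i : ℝ)) ∈ levCone lev := by
  have hsum : ∀ U : Finset (Fin n), ∑ i ∈ U, (∑ e, (m e : ℤ) • root e) i
      = ∑ e, (m e : ℤ) * ∑ i ∈ U, root e i := by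
    intro U
    simp only [Finset.sum_apply, Pi.smul_apply, smul_eq_mul]
    rw [Finset.sum_comm]
    simp only [Finset.mul_sum]
  refine ⟨?_, fun U hU => ?_⟩
  · have h := hsum univ
    simp only [sum_root, mul_zero, Finset.sum_const_zero] at h
    beta_reduce
    exact_mod_cast h
  · suffices h : 0 ≤ ∑ i ∈ U, (∑ e, (m e : ℤ) • root e) i by beta_reduce; exact_mod_cast h
    rw [hsum]
    refine Finset.sum_nonneg fun e _ => ?_
    by_cases he : e ∈ levRoots lev
    · refine mul_nonneg (Int.natCast_nonneg _) ?_
      simp only [levRoots, mem_filter, mem_univ, true_and] at he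
      simp only [root, Pi.sub_apply, Finset.sum_sub_distrib, Pi.single_apply, Finset.sum_ite_eq']
      split_ifs with h1 h2 h2
      · simp
      · simp
      · exact absurd (hU _ h2 _ he) h1
      · simp
    · simp [hm e he]

/-- Pigeonhole on the families with entries at most `T`: a fibre of the sum map has at most as many
elements as the value of `F` there, which is `O(T ^ d)`. Comparing growth in `T` gives the
inequality of exponents. -/
theorem card_levRoots_le {k : ℕ} (lev : Fin (k + 1) → ℕ) {F : (Fin (k + 1) → ℝ) → ℝ}
    (hF : ∀ γ : Fin (k + 1) → ℤ, (fun i => (γ i : ℝ)) ∈ levCone lev →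
      F (fun i => (γ i : ℝ)) = (countOn (levRoots lev) γ : ℝ)) {d : ℕ}
    (hd : IsPiecewisePolynomialOfDegreeLE (levCone lev) F d) : #(levRoots lev) ≤ k + d := by
  classical
  obtain ⟨c, hc, hcF⟩ := abs_le_of_isPiecewisePolynomial hd
  set Φ := levRoots lev with hΦ
  set L : ℕ := Fintype.card (Fin (k + 1) × Fin (k + 1)) with hL
  set vec : (Fin (k + 1) × Fin (k + 1) → ℕ) → Fin (k + 1) → ℤ :=
    fun m => ∑ e, (m e : ℤ) • root e with hvec
  have hvec0 : ∀ m, ∑ i, vec m i = 0 := by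
    intro m
    simp only [hvec, Finset.sum_apply, Pi.smul_apply, smul_eq_mul]
    rw [Finset.sum_comm]
    simp [← Finset.mul_sum, sum_root]
  have hbound : ∀ T : ℕ, ((T : ℝ) + 1) ^ #Φ ≤ c * (2 * L + 1) ^ (k + d) * ((T : ℝ) + 1) ^ (k + d) := by
    intro T
    set M : Finset (Fin (k + 1) × Fin (k + 1) → ℕ) :=
      Fintype.piFinset fun e => if e ∈ Φ then range (T + 1) else {0} with hM
    have hMmem : ∀ m ∈ M, (∀ e ∉ Φ, m e = 0) ∧ ∀ e, m e ≤ T := by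
      intro m hm
      rw [hM, Fintype.mem_piFinset] at hm
      refine ⟨fun e he => ?_, fun e => ?_⟩
      · simpa [he] using hm e
      · have := hm e
        split_ifs at this with he
        · rw [mem_range] at this; omega
        · rw [mem_singleton] at this; omega
    have hMcard : #M = (T + 1) ^ #Φ := by
      rw [hM, Fintype.card_piFinset]
      have : ∀ e, #(if e ∈ Φ then range (T + 1) else {0}) = if e ∈ Φ then T + 1 else 1 := by
        intro e; split_ifs <;> simp
      rw [Finset.prod_congr rfl fun e _ => this e]
      simp [Finset.prod_ite_mem]
    have hvecabs : ∀ m ∈ M, ∀ i, |vec m i| ≤ L * T := by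
      intro m hm i
      simp only [hvec, Finset.sum_apply, Pi.smul_apply, smul_eq_mul]
      refine (Finset.abs_sum_le_sum_abs _ _).trans ?_
      have : ∀ e ∈ (univ : Finset (Fin (k + 1) × Fin (k + 1))), |(m e : ℤ) * root e i| ≤ T := by
        intro e _
        rw [abs_mul, Nat.abs_cast]
        have h1 : |root e i| ≤ 1 := by
          simp only [root, Pi.sub_apply, Pi.single_apply]
          split_ifs <;> simp
        have h2 : (m e : ℤ) ≤ T := by exact_mod_cast (hMmem m hm).2 e
        calc (m e : ℤ) * |root e i| ≤ m e * 1 := by gcongr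
          _ ≤ T := by linarith
      refine (Finset.sum_le_sum this).trans ?_
      rw [Finset.sum_const, nsmul_eq_mul, card_univ]
    -- The last coordinate is determined by the zero sum, so the box needs only `k` dimensions.
    set box : Finset (Fin k → ℤ) := Fintype.piFinset fun _ => Icc (-(L * T : ℤ)) (L * T) with hbox
    have hboxcard : #box = (2 * L * T + 1) ^ k := by
      rw [hbox, Fintype.card_piFinset]
      simp only [Int.card_Icc, Finset.prod_const, card_univ, Fintype.card_fin]
      congr 1
      have h : (L * T : ℤ) + 1 - -(L * T) = ((2 * L * T + 1 : ℕ) : ℤ) := by push_cast; ring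
      rw [h, Int.toNat_natCast]
    have hmaps : ∀ m ∈ M, (fun i : Fin k => vec m i.castSucc) ∈ box := by
      intro m hm
      rw [hbox, Fintype.mem_piFinset]
      intro i
      rw [mem_Icc, ← abs_le]
      exact hvecabs m hm _
    have hfib : ∀ δ ∈ box, #(M.filter fun m => (fun i : Fin k => vec m i.castSucc) = δ)
        ≤ ⌊c * ((L * T : ℝ) + 1) ^ d⌋₊ := by
      intro δ _
      rcases (M.filter fun m => (fun i : Fin k => vec m i.castSucc) = δ).eq_empty_or_nonempty
        with h | ⟨m₀, hm₀⟩
      · rw [h]; simp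
      obtain ⟨hm₀M, hm₀δ⟩ := mem_filter.1 hm₀
      refine Nat.le_floor ?_
      have hsub : ((M.filter fun m => (fun i : Fin k => vec m i.castSucc) = δ : Finset _) :
          Set (Fin (k + 1) × Fin (k + 1) → ℕ)) ⊆ partitionsOn Φ (vec m₀) := by
        intro m hm
        obtain ⟨hmM, hmδ⟩ := mem_filter.1 (mem_coe.1 hm)
        refine ⟨(hMmem m hmM).1, ?_⟩
        have hcs : ∀ i : Fin k, vec m i.castSucc = vec m₀ i.castSucc := by
          intro i
          exact congrFun (hmδ.trans hm₀δ.symm) i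
        have h1 := hvec0 m
        have h2 := hvec0 m₀
        rw [Fin.sum_univ_castSucc] at h1 h2
        rw [Finset.sum_congr rfl fun i _ => hcs i] at h1
        show vec m = vec m₀
        funext i
        refine Fin.lastCases ?_ hcs i
        linarith
      have h1 := Set.ncard_le_ncard hsub (partitionsOn_finite (levRoots_height lev) _)
      rw [Set.ncard_coe_finset] at h1
      have hmem := sum_smul_root_mem_levCone lev m₀ (hMmem m₀ hm₀M).1
      have h2 := hF (vec m₀) hmem
      have h3 := hcF _ hmem ((L * T : ℝ) + 1) (by
        have : (0 : ℝ) ≤ L * T := by positivity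
        linarith) (by
        intro i
        have h4 : ((|vec m₀ i| : ℤ) : ℝ) ≤ ((L * T : ℤ) : ℝ) :=
          Int.cast_le.2 (hvecabs m₀ hm₀M i)
        push_cast at h4
        exact h4.trans (by linarith))
      have h5 : F (fun i => (vec m₀ i : ℝ)) ≤ c * ((L * T : ℝ) + 1) ^ d := (le_abs_self _).trans h3
      rw [h2, countOn, Rat.cast_natCast] at h5
      exact (by exact_mod_cast h1 : (_ : ℝ) ≤ _).trans h5
    have hcard := Finset.card_le_mul_card_image_of_maps_to hmaps _ hfib
    rw [hMcard, hboxcard] at hcard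
    have hcard' : ((T : ℝ) + 1) ^ #Φ
        ≤ (⌊c * ((L * T : ℝ) + 1) ^ d⌋₊ : ℝ) * (2 * L * T + 1) ^ k := by exact_mod_cast hcard
    refine hcard'.trans ?_
    have h1 : (⌊c * ((L * T : ℝ) + 1) ^ d⌋₊ : ℝ) ≤ c * ((L * T : ℝ) + 1) ^ d :=
      Nat.floor_le (by positivity)
    have hL0 : (0 : ℝ) ≤ L := Nat.cast_nonneg _
    have hT0 : (0 : ℝ) ≤ T := Nat.cast_nonneg _
    have hLT : (0 : ℝ) ≤ L * T := mul_nonneg hL0 hT0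
    have h2 : (L * T : ℝ) + 1 ≤ (2 * L + 1) * (T + 1) := by nlinarith
    have h3 : (2 * L * T : ℝ) + 1 ≤ (2 * L + 1) * (T + 1) := by nlinarith
    calc (⌊c * ((L * T : ℝ) + 1) ^ d⌋₊ : ℝ) * (2 * L * T + 1) ^ k
        ≤ (c * ((2 * L + 1) * (T + 1)) ^ d) * ((2 * L + 1) * (T + 1)) ^ k := by
          refine mul_le_mul (h1.trans ?_) ?_ (by positivity) (by positivity)
          · gcongr
          · gcongr
      _ = c * (2 * L + 1) ^ (k + d) * ((T : ℝ) + 1) ^ (k + d) := by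
          rw [mul_pow, mul_pow, pow_add, pow_add]; ring
  by_contra hlt
  push Not at hlt
  set A : ℝ := c * (2 * L + 1) ^ (k + d) with hA
  obtain ⟨T, hT⟩ := exists_nat_gt A
  have h1 := hbound T
  have h2 : ((T : ℝ) + 1) ^ (k + d + 1) ≤ ((T : ℝ) + 1) ^ #Φ :=
    pow_le_pow_right₀ (by linarith [(Nat.cast_nonneg T : (0 : ℝ) ≤ T)]) hlt
  have hpos : (0 : ℝ) < ((T : ℝ) + 1) ^ (k + d) := by positivity
  rw [pow_succ] at h2
  have h3 : ((T : ℝ) + 1) ^ (k + d) * (T + 1) ≤ ((T : ℝ) + 1) ^ (k + d) * A := by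
    linarith
  have := le_of_mul_le_mul_left h3 hpos
  linarith

/-- The `k` edges of a frame are distinct roots. This keeps the natural-number subtraction in the
degree from truncating. -/
theorem le_card_levRoots (lev : Fin n → ℕ) {k : ℕ} (hn : n = k + 1)
    (hlev : ((∃ i, lev i = 0) ∧ ∃ j, lev j ≠ 0) ∨ n = 1) : k ≤ #(levRoots lev) := by
  obtain ⟨ξ, h1, h2, -⟩ := exists_smallGeneric_chamber lev hlev (x := 0)
    ⟨by simp, fun U _ => by simp⟩
  obtain ⟨B, -⟩ := exists_frame_pos lev hn h2.sum_eq_zero h2.sum_ne_zero h1.2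
  have := Finset.card_le_card_of_injOn (s := univ) (t := levRoots lev) B.edge
    (fun t _ => B.mem t) (B.edge_injective.injOn)
  simpa using this

end ParabolicKostant

/-! ### Translation from compositions to levels -/

namespace ParabolicKostant

open Finset

variable {n : ℕ}

theorem lt_sizeUpTo_iff (η : Composition n) (a : Fin n) (k : ℕ) :
    (a : ℕ) < η.sizeUpTo k ↔ (η.index a : ℕ) < k := by
  constructor
  · intro h
    by_contra hk
    have h1 := η.monotone_sizeUpTo (not_lt.1 hk)
    have h2 := η.sizeUpTo_index_le a
    omega
  · intro h
    exact (η.lt_sizeUpTo_index_succ a).trans_le (η.monotone_sizeUpTo h)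

theorem Phi_eq_levRoots (η : Composition n) :
    Phi η = levRoots fun i => (η.index i : ℕ) := by
  ext ⟨i, j⟩
  simp only [Phi, levRoots, mem_filter, mem_univ, true_and]
  constructor
  · rintro ⟨k, -, h1, h2⟩
    rw [lt_sizeUpTo_iff] at h1
    rw [← not_lt, lt_sizeUpTo_iff] at h2
    omega
  · intro h
    -- The start of the block of `j` separates the two positions.
    refine ⟨(η.index j).castSucc, ?_, ?_, ?_⟩
    · simp only [Fin.val_castSucc]; omega
    · rw [lt_sizeUpTo_iff]; exact h
    · rw [← not_lt, lt_sizeUpTo_iff]; simp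

/-- A non-empty set closed under lower levels consists of all blocks below its highest one together
with an arbitrary part `Ω` of that block. -/
theorem mem_Y_iff (R : Type*) [CommRing R] [LinearOrder R] [IsStrictOrderedRing R]
    (η : Composition n) (γ : Fin n → R) : γ ∈ Y R η ↔ ∑ i, γ i = 0 ∧
      ∀ U, IsLevUpper (fun i => (η.index i : ℕ)) U → 0 ≤ ∑ i ∈ U, γ i := by
  classical
  refine and_congr_right fun h0 => ?_
  have hdisj : ∀ (k : ℕ) (Ω : Finset (Fin n)),
      (∀ a ∈ Ω, η.sizeUpTo k ≤ (a : ℕ) ∧ (a : ℕ) < η.sizeUpTo (k + 1)) →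
      Disjoint (univ.filter fun j : Fin n => j.val < η.sizeUpTo k) Ω := by
    intro k Ω hΩ
    rw [Finset.disjoint_left]
    intro a ha haΩ
    have := (hΩ a haΩ).1
    simp only [mem_filter, mem_univ, true_and] at ha
    omega
  constructor
  · intro h U hU
    rcases U.eq_empty_or_nonempty with rfl | hne
    · simp
    obtain ⟨u, hu, humax⟩ := Finset.exists_max_image U (fun i => (η.index i : ℕ)) hne
    have hΩ : ∀ a ∈ U.filter fun a => (η.index a : ℕ) = η.index u,
        η.sizeUpTo (η.index u) ≤ (a : ℕ) ∧ (a : ℕ) < η.sizeUpTo ((η.index u : ℕ) + 1) := by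
      intro a ha
      have ha := (mem_filter.1 ha).2
      rw [← not_lt, lt_sizeUpTo_iff, lt_sizeUpTo_iff]
      omega
    have h1 := h (η.index u) (η.index u).2 _ hΩ
    rw [← Finset.sum_union (hdisj _ _ hΩ)] at h1
    convert h1 using 2
    ext a
    simp only [mem_union, mem_filter, mem_univ, true_and, lt_sizeUpTo_iff]
    constructor
    · intro ha
      have := humax a ha
      rcases this.lt_or_eq with h2 | h2
      · exact Or.inl h2
      · exact Or.inr ⟨ha, h2⟩
    · rintro (ha | ha)
      · exact hU u hu a ha
      · exact ha.1
  · intro h k _ Ω hΩ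
    rw [← Finset.sum_union (hdisj k Ω hΩ)]
    refine h _ fun u hu v huv => ?_
    simp only [mem_union, mem_filter, mem_univ, true_and, lt_sizeUpTo_iff] at hu ⊢
    left
    beta_reduce at huv
    rcases hu with hu | hu
    · omega
    · have := (hΩ u hu).2
      rw [lt_sizeUpTo_iff] at this
      omega

theorem Y_real_eq_levCone (η : Composition n) :
    Y ℝ η = levCone fun i => (η.index i : ℕ) :=
  Set.ext fun γ => mem_Y_iff ℝ η γ

theorem mem_levCone_of_mem_Y (η : Composition n) {γ : Fin n → ℤ} (h : γ ∈ Y ℤ η) :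
    (fun i => (γ i : ℝ)) ∈ levCone fun i => (η.index i : ℕ) := by
  rw [mem_Y_iff] at h
  refine ⟨by beta_reduce; exact_mod_cast h.1, fun U hU => ?_⟩
  beta_reduce
  exact_mod_cast h.2 U hU

theorem kostantK_eq_countOn (η : Composition n) (γ : Fin n → ℤ) :
    (kostantK η γ : ℚ) = countOn (Phi η) γ := by
  rw [countOn, kostantK, Nat.cast_inj]
  have hsum : ∀ m : Fin n × Fin n → ℕ, (∀ e ∉ Phi η, m e = 0) →
      ∑ e, (m e : ℤ) • root e = ∑ e : {e // e ∈ Phi η}, m e.1 • root e.1 := by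
    intro m hm
    rw [Finset.sum_coe_sort (Phi η) fun e => m e • root e]
    rw [← Finset.sum_subset (subset_univ (Phi η))]
    · exact Finset.sum_congr rfl fun e _ => natCast_zsmul _ _
    · intro e _ he
      simp [hm e he]
  have himg : kostantPartitions η γ
      = (fun (m : Fin n × Fin n → ℕ) (e : {e // e ∈ Phi η}) => m e.1) '' partitionsOn (Phi η) γ := by
    ext m
    constructor
    · intro hm
      refine ⟨fun e => if h : e ∈ Phi η then m ⟨e, h⟩ else 0, ⟨fun e he => by simp [he], ?_⟩, ?_⟩
      · rw [hsum _ fun e he => by simp [he]]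
        simpa [kostantPartitions] using hm
      · funext e
        simp
    · rintro ⟨m, ⟨h1, h2⟩, rfl⟩
      rw [hsum m h1] at h2
      exact h2
  rw [himg, Set.InjOn.ncard_image]
  intro m hm m' hm' h
  funext e
  by_cases he : e ∈ Phi η
  · exact congrFun h ⟨e, he⟩
  · rw [hm.1 e he, hm'.1 e he]

theorem card_index_eq (η : Composition n) (i : Fin η.length) :
    #(univ.filter fun a => η.index a = i) = η.blocksFun i := by
  have : (univ.filter fun a => η.index a = i) = univ.map (η.embedding i).toEmbedding := by
    ext a
    have := η.mem_range_embedding_iff' (j := a) (i := i)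
    simp only [mem_filter, mem_univ, true_and, mem_map]
    rw [Set.mem_range] at this
    rw [eq_comm, ← this]
    rfl
  rw [this, card_map, card_univ, Fintype.card_fin]

theorem card_levRoots_index (η : Composition n) :
    #(levRoots fun i => (η.index i : ℕ))
      = ∑ i : Fin η.length, ∑ j ∈ Ioi i, η.blocksFun i * η.blocksFun j := by
  rw [Finset.sum_sigma' univ (fun i => Ioi i) fun i j => η.blocksFun i * η.blocksFun j]
  rw [Finset.card_eq_sum_card_fiberwise
    (f := fun e : Fin n × Fin n => (⟨η.index e.1, η.index e.2⟩ : Σ _ : Fin η.length, Fin η.length))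
    (t := univ.sigma fun i => Ioi i)]
  · refine Finset.sum_congr rfl ?_
    rintro ⟨i, j⟩ hij
    simp only [mem_sigma, mem_univ, true_and, mem_Ioi] at hij
    rw [← card_index_eq η i, ← card_index_eq η j, ← card_product]
    congr 1
    ext ⟨a, b⟩
    simp only [levRoots, mem_filter, mem_univ, true_and, mem_product, Sigma.mk.injEq, heq_eq_eq]
    constructor
    · exact fun h => h.2
    · rintro ⟨rfl, rfl⟩
      exact ⟨hij, rfl, rfl⟩
  · rintro ⟨a, b⟩ h
    simpa [levRoots] using h

end ParabolicKostant

open ParabolicKostant Finset in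
theorem theorem3p25 {n : ℕ} (η : Composition n) (hη : 2 ≤ η.length ∨ n = 1) :
    ∃ (F : (Fin n → ℝ) → ℝ) (d : ℕ),
      (∀ γ ∈ ParabolicKostant.Y ℤ η,
        F (fun i => (γ i : ℝ)) = (ParabolicKostant.kostantK η γ : ℝ)) ∧
      ContinuousOn F (ParabolicKostant.Y ℝ η) ∧
      ParabolicKostant.IsPiecewisePolynomialOfDegree (ParabolicKostant.Y ℝ η) F d ∧
      (d : ℤ) = (∑ i : Fin η.length, ∑ j ∈ Finset.Ioi i,
        (η.blocksFun i : ℤ) * (η.blocksFun j : ℤ)) - n + 1 := by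
  have hlev : ((∃ i, (η.index i : ℕ) = 0) ∧ ∃ j, (η.index j : ℕ) ≠ 0) ∨ n = 1 := by
    refine hη.imp_left fun h => ⟨?_, ?_⟩
    · exact ⟨η.embedding ⟨0, by omega⟩ ⟨0, η.blocks_pos' _ _⟩, by rw [η.index_embedding]⟩
    · exact ⟨η.embedding ⟨1, by omega⟩ ⟨0, η.blocks_pos' _ _⟩, by rw [η.index_embedding]; simp⟩
  obtain ⟨k, rfl⟩ : ∃ k, n = k + 1 := by
    refine Nat.exists_eq_succ_of_ne_zero ?_
    rintro rfl
    rcases hlev with ⟨⟨i, -⟩, -⟩ | h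
    · exact i.elim0
    · omega
  obtain ⟨F, h1, h2, h3⟩ := exists_piecewise (fun i => (η.index i : ℕ)) rfl hlev
  have hk := le_card_levRoots (fun i => (η.index i : ℕ)) rfl hlev
  rw [Y_real_eq_levCone]
  refine ⟨F, _, fun γ hγ => ?_, h2, ⟨h3, fun d hd => ?_⟩, ?_⟩
  · rw [h1 γ (mem_levCone_of_mem_Y η hγ), ← Phi_eq_levRoots, ← kostantK_eq_countOn]
    simp
  · have := card_levRoots_le _ h1 hd
    omega
  · have hc := card_levRoots_index η
    push_cast [Nat.cast_sub hk]
    have hc' : (#(levRoots fun i => (η.index i : ℕ)) : ℤ) = ∑ i : Fin η.length, ∑ j ∈ Ioi i,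
        (η.blocksFun i : ℤ) * (η.blocksFun j : ℤ) := by
      rw [hc]; push_cast; rfl
    rw [hc']
    ring
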